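/- **Notation.** For integers $n\ge 3$ and $r\ge 0$ let $X_{n,r}(x)={}_2F_1(-r,-r-1/n;\,1-1/n;\,x)\in\mathbb{Q}[x]$. Let $D_{n,r}$ be the smallest positive integer such that $D_{n,r}X_{n,r}(x)$ has rational integer coefficients and, for a positive integer $d$, let $N_{d,n,r}$ be the greatest common divisor of the numerators of the coefficients of $X_{n,r}(1-dx)$. Put $$\mathcal{N}_{d,n}=\prod_{p\mid n}p^{\min\left(v_p(d),\,v_p(n)+1/(p-1)\right)},$$ the product being over the primes $p$ dividing $n$. Roots $w^{1/n}$ and $\sqrt{w}=w^{1/2}$ of complex numbers are principal: if $w=se^{i\varphi}$ with $s\ge 0$, $-\pi<\varphi\le\pi$, then $w^{1/n}=s^{1/n}e^{i\varphi/n}$. **Statement.** Let $K\subset\mathbb{C}$ be an imaginary quadratic field with ring of integers $\mathcal{O}_K$, and let $n\ge 3$ be an integer. Let $a\neq b$ be elements of $\mathcal{O}_K$ with $b\ne 0$ such that the ideal $(a,b)$ equals $\mathcal{O}_K$, and such that either $a/b$ is a rational number $>1$, or $|a/b|=1$ and $a/b\neq-1$. Let $d$ be the largest positive rational integer such that $(a-b)/d$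 is an algebraic integer. Let $\mathcal{C}_n,\mathcal{D}_n$ be positive real numbers such that $$\max\left(1,\frac{\Gamma(1-1/n)\,r!}{\Gamma(r+1-1/n)},\frac{n\,\Gamma(r+1+1/n)}{\Gamma(1/n)\,r!}\right)\frac{D_{n,r}}{N_{d,n,r}}<\mathcal{C}_n\left(\frac{\mathcal{D}_n}{\mathcal{N}_{d,n}}\right)^{r}$$ for all integers $r\ge 0$. Put $$E=\frac{\mathcal{N}_{d,n}}{\mathcal{D}_n}\left\{\min\left(|\sqrt a-\sqrt b|,|\sqrt a+\sqrt b|\right)\right\}^{-2},\qquad Q=\frac{\mathcal{D}_n}{\mathcal{N}_{d,n}}\left\{\max\left(|\sqrt a-\sqrt b|,|\sqrt a+\sqrt b|\right)\right\}^{2},$$ $$\kappa=\frac{\log Q}{\log E},\qquad c=4|a|\,\mathcal{C}_n\,Q\left(2.5\left|\frac{a(a-b)}{b}\right|\mathcal{C}_n\,E\right)^{\kappa}.$$ If $E>1$, then $$\left|(a/b)^{1/n}-\frac pq\right|>\frac{1}{c\,|q|^{\kappa+1}}$$ for all $p,q\in\mathcal{O}_K$ with $q\neq 0$. -/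

import Mathlib

open Polynomial NumberField

noncomputable section

/-- The hypergeometric polynomial `X_{n,r}(x) = ₂F₁(-r, -r - 1/n; 1 - 1/n; x)`, with rational
coefficients (the series terminates after the term of degree `r`). -/
def hypX (n r : ℕ) : ℚ[X] :=
  ∑ k ∈ Finset.range (r + 1),
    C (ordinaryHypergeometricCoefficient (-(r : ℚ)) (-(r : ℚ) - 1 / (n : ℚ)) (1 - 1 / (n : ℚ)) k)
      * X ^ k

/-- `D_{n,r}`: the smallest positive integer `D` such that `D * X_{n,r}` has integer
coefficients. -/
def denomD (n r : ℕ) : ℕ :=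
  sInf {D : ℕ | 0 < D ∧ ∀ k : ℕ, ∃ z : ℤ, (D : ℚ) * (hypX n r).coeff k = (z : ℚ)}

/-- `N_{d,n,r}`: the greatest common divisor of the numerators (in lowest terms) of the
coefficients of the polynomial `X_{n,r}(1 - d x)`. -/
def numerN (d n r : ℕ) : ℕ :=
  (Finset.range (r + 1)).gcd
    (fun k => (((hypX n r).comp (1 - C (d : ℚ) * X)).coeff k).num.natAbs)

/-- `𝒩_{d,n} = ∏_{p ∣ n} p ^ min (v_p(d), v_p(n) + 1/(p-1))`, the product over the primes
dividing `n`. -/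
def scriptN (d n : ℕ) : ℝ :=
  ∏ p ∈ n.primeFactors,
    (p : ℝ) ^ (min (padicValNat p d : ℝ) ((padicValNat p n : ℝ) + 1 / ((p : ℝ) - 1)))

/-- The condition on a pair `(𝒞, 𝒟)` of real numbers relative to `d` and `n`: both are positive,
and for all `r ≥ 0`,
`max (1, Γ(1-1/n) r! / Γ(r+1-1/n), n Γ(r+1+1/n) / (Γ(1/n) r!)) * D_{n,r} / N_{d,n,r}`
is smaller than `𝒞 (𝒟 / 𝒩_{d,n})^r`. -/
def IsAdmissible (d n : ℕ) (Cn Dn : ℝ) : Prop :=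
  0 < Cn ∧ 0 < Dn ∧ ∀ r : ℕ,
    max 1 (max
        (Real.Gamma (1 - 1 / (n : ℝ)) * (r.factorial : ℝ) / Real.Gamma ((r : ℝ) + 1 - 1 / (n : ℝ)))
        ((n : ℝ) * Real.Gamma ((r : ℝ) + 1 + 1 / (n : ℝ)) /
          (Real.Gamma (1 / (n : ℝ)) * (r.factorial : ℝ))))
      * ((denomD n r : ℝ) / (numerN d n r : ℝ))
    < Cn * (Dn / scriptN d n) ^ r

end

noncomputable section

/-! The hypergeometric method of Thue and Siegel. With `s = 1/n` and `z = a/b = exp w`, the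
polynomial `hypPoly s r` and its reciprocal `hypPolyRev s r` give a Padé approximation: `z^s *
hypPolyRev - hypPoly` vanishes to order `2r+1` at `z = 1`. Put `R_r = (D/N) a^r X_r(b/a)` and `P_r =
(D/N) b^r X_r(a/b)`. Since `d` divides `a - b`, both are algebraic integers
(`exists_ringOfIntegers_eq`).

Three facts make `P_r / R_r` good approximations to `θ = z^s`. The remainder is an integral along
the path `exp (v w)` from `1` to `z`, whose kernel is largest at the midpoint `√z`; hence `R_r θ -
P_r` is of size `E^(-r)` (`norm_hyp_remainder_le`). The polynomial at `1/z` is at most a constant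
times `|1 + 1/√z|^(2r)` after normalization, so `R_r` is of size `Q^r`
(`norm_sum_hypCoeff_mul_exp_neg_le`). Consecutive approximations differ, because their determinant
is a nonzero multiple of `(z-1)^(2r+1)` (`hyp_det_ne_zero`).

A nonzero integer of an imaginary quadratic field has absolute value at least `1`. Applied to `p R_j
- q P_j`, with `j` chosen according to the size of `q`, this gives the bound
(`lt_norm_sub_div_of_approx`). -/

/-! ### Hypergeometric coefficients and partial fractions -/

/-- The coefficients of `₂F₁(-r, -r - s; 1 - s; x)`. -/
def hypCoeff (s : ℝ) (r k : ℕ) : ℝ :=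
  r.choose k * ∏ i ∈ Finset.range k, ((r + s - i) / (1 - s + i))

lemma hypCoeff_zero (s : ℝ) (r : ℕ) : hypCoeff s r 0 = 1 := by simp [hypCoeff]

lemma hypCoeff_pos {s : ℝ} (h0 : 0 < s) (h1 : s < 1) {r k : ℕ} (hk : k ≤ r) :
    0 < hypCoeff s r k := by
  have := Nat.choose_pos hk
  refine mul_pos (by exact_mod_cast this) (Finset.prod_pos fun i hi => ?_)
  have h2 : (i : ℝ) + 1 ≤ r := by
    exact_mod_cast (Finset.mem_range.1 hi).trans_le hk
  have h3 : (0 : ℝ) ≤ i := i.cast_nonneg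
  exact div_pos (by linarith) (by linarith)

lemma eval_ascPochhammer_eq_prod {F : Type*} [CommRing F] (x : F) (k : ℕ) :
    (ascPochhammer F k).eval x = ∏ i ∈ Finset.range k, (x + i) := by
  induction k with
  | zero => simp
  | succ k ih => rw [ascPochhammer_succ_eval, ih, Finset.prod_range_succ]

lemma prod_neg_natCast_add (r k : ℕ) :
    ∏ i ∈ Finset.range k, (-(r : ℝ) + i) = (-1) ^ k * (k.factorial * r.choose k) := by
  rw [← Nat.cast_mul, ← Nat.descFactorial_eq_factorial_mul_choose]
  induction k with
  | zero => simp
  | succ k ih =>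
    rw [Finset.prod_range_succ, ih, Nat.descFactorial_succ]
    rcases le_or_gt k r with h | h
    · push_cast [h]; ring
    · rw [Nat.descFactorial_of_lt h]; simp

lemma cast_hypergeometricCoefficient (n r k : ℕ) :
    ((ordinaryHypergeometricCoefficient (-(r : ℚ)) (-(r : ℚ) - 1 / (n : ℚ)) (1 - 1 / (n : ℚ)) k : ℚ)
      : ℝ) = hypCoeff (1 / n) r k := by
  unfold ordinaryHypergeometricCoefficient hypCoeff
  rw [eval_ascPochhammer_eq_prod, eval_ascPochhammer_eq_prod, eval_ascPochhammer_eq_prod]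
  push_cast
  rw [prod_neg_natCast_add, Finset.prod_div_distrib]
  have h : ∏ i ∈ Finset.range k, (-(r : ℝ) - 1 / n + i)
      = (-1) ^ k * ∏ i ∈ Finset.range k, ((r : ℝ) + 1 / n - i) := by
    rw [show (-1 : ℝ) ^ k = ∏ i ∈ Finset.range k, (-1 : ℝ) by simp, ← Finset.prod_mul_distrib]
    exact Finset.prod_congr rfl fun i _ => by ring
  rw [h]
  have hf : (k.factorial : ℝ) ≠ 0 := by positivity
  have hs : ((-1 : ℝ) ^ k) * (-1) ^ k = 1 := by rw [← mul_pow]; simp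
  field_simp
  linear_combination (∏ x ∈ Finset.range k, ((r : ℝ) + 1 / n - x)) * (r.choose k : ℝ) *
    (∏ i ∈ Finset.range k, (1 - 1 / (n : ℝ) + i))⁻¹ * hs

lemma coeff_hypX (n r k : ℕ) : (((hypX n r).coeff k : ℚ) : ℝ) = hypCoeff (1 / n) r k := by
  rw [← cast_hypergeometricCoefficient]
  unfold hypX
  simp only [finsetSum_coeff, coeff_C_mul_X_pow]
  rw [Finset.sum_ite_eq]
  split_ifs with h
  · rfl
  · rw [cast_hypergeometricCoefficient, hypCoeff, Nat.choose_eq_zero_of_lt (by simpa using h)]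
    simp

/-- This is the partial fraction expansion of `r! / (x (x+1) ⋯ (x+r))`. By Pascal's rule the sum for
`r+1` is the difference of the sums for `r` at `x` and at `x+1`. -/
lemma sum_neg_one_pow_choose_div {F : Type*} [Field F] (r : ℕ) (x : F)
    (hx : ∀ i ≤ r, x + i ≠ 0) :
    ∑ k ∈ Finset.range (r + 1), (-1) ^ k * (r.choose k : F) / (x + k)
      = r.factorial / ∏ i ∈ Finset.range (r + 1), (x + i) := by
  induction r generalizing x with
  | zero => simp
  | succ r ih =>
    have e := Finset.sum_choose_succ_mul (R := F) (fun i _ => (-1) ^ i / (x + i)) r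
    have h1 := ih x fun i hi => hx i (by omega)
    have h2 := ih (x + 1) fun i hi => by
      have := hx (i + 1) (by omega)
      push_cast at this; convert this using 1; ring
    have e1 : ∏ i ∈ Finset.range (r + 1 + 1), (x + i)
        = (∏ i ∈ Finset.range (r + 1), (x + i)) * (x + (r + 1)) := by
      rw [Finset.prod_range_succ]; push_cast; rfl
    have e2 : ∏ i ∈ Finset.range (r + 1 + 1), (x + i)
        = (∏ i ∈ Finset.range (r + 1), (x + 1 + i)) * x := by
      rw [Finset.prod_range_succ']
      push_cast
      simp only [add_zero, add_assoc, add_comm (1 : F)]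
    have n0 : ∏ i ∈ Finset.range (r + 1 + 1), (x + i) ≠ 0 :=
      Finset.prod_ne_zero_iff.2 fun i hi => hx i (by simpa [Nat.lt_succ_iff] using hi)
    have n1 := n0
    have n2 := n0
    rw [e1] at n1
    rw [e2] at n2
    have : ∑ k ∈ Finset.range (r + 1 + 1), (-1) ^ k * ((r + 1).choose k : F) / (x + k)
      = ∑ k ∈ Finset.range (r + 1), (-1) ^ k * (r.choose k : F) / (x + k)
        - ∑ k ∈ Finset.range (r + 1), (-1) ^ k * (r.choose k : F) / (x + 1 + k) := by
      rw [← Finset.sum_sub_distrib]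
      refine (Finset.sum_congr rfl fun k _ => ?_).trans (e.trans ?_)
      · ring
      rw [← Finset.sum_add_distrib]
      refine Finset.sum_congr rfl fun k _ => ?_
      push_cast
      rw [show x + ((k : F) + 1) = x + 1 + k by ring, pow_succ]
      ring
    rw [this, h1, h2]
    have e3 : (∏ i ∈ Finset.range (r + 1), (x + i)) * (x + (r + 1))
        = (∏ i ∈ Finset.range (r + 1), (x + 1 + i)) * x := e1.symm.trans e2
    rw [e1, div_sub_div _ _ (left_ne_zero_of_mul n1) (left_ne_zero_of_mul n2),
      div_eq_div_iff (mul_ne_zero (left_ne_zero_of_mul n1) (left_ne_zero_of_mul n2)) n1,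
      Nat.factorial_succ]
    push_cast
    linear_combination (-(r.factorial : F) * (∏ i ∈ Finset.range (r + 1), (x + i))) * e3

/-- The coefficients of the hypergeometric polynomial from partial fractions. -/
lemma prod_mul_choose_div_prod {s : ℝ} (h0 : 0 < s) (h1 : s < 1) {r m : ℕ} (hm : m ≤ r) :
    (∏ i ∈ Finset.range (r + 1), (s + i)) *
      ((-1) ^ m * r.choose m / ∏ i ∈ Finset.range (r + 1), (s - m + i)) = hypCoeff s r m := by
  induction m with
  | zero =>
    have : ∏ i ∈ Finset.range (r + 1), (s + (i : ℝ)) ≠ 0 := by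
      refine Finset.prod_ne_zero_iff.2 fun i _ => by positivity
    simp [hypCoeff_zero, this]
  | succ m ih =>
    have ih := ih (by omega)
    have e1 : (∏ i ∈ Finset.range (r + 1), (s - m + i)) * (s - (m + 1))
        = (∏ i ∈ Finset.range (r + 1), (s - (m + 1 : ℕ) + i)) * (s - m + r) := by
      have a1 := Finset.prod_range_succ' (fun i : ℕ => s - (m + 1 : ℕ) + i) (r + 1)
      have a2 := Finset.prod_range_succ (fun i : ℕ => s - (m + 1 : ℕ) + i) (r + 1)
      rw [a2] at a1
      push_cast at a1 ⊢
      have a3 : ∏ i ∈ Finset.range (r + 1), (s - m + (i : ℝ))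
        = ∏ i ∈ Finset.range (r + 1), (s - (m + 1) + ((i : ℝ) + 1)) :=
        Finset.prod_congr rfl fun i _ => by ring
      rw [a3]
      linear_combination -a1
    have hmr : (m : ℝ) + 1 ≤ r := by exact_mod_cast hm
    have hm0 : (0 : ℝ) ≤ m := m.cast_nonneg
    have d1 : s - (m + 1) ≠ 0 := by linarith
    have d2 : s - m + r ≠ 0 := by linarith
    have d3 : 1 - s + m ≠ 0 := by linarith
    have d4 : ∀ m : ℕ, ∏ i ∈ Finset.range (r + 1), (s - m + (i : ℝ)) ≠ 0 := by
      intro m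
      refine Finset.prod_ne_zero_iff.2 fun i _ h => ?_
      have h4 : ((m : ℤ) - i : ℝ) = s := by push_cast; linarith
      have h5 : (0 : ℝ) < ((m - i : ℤ) : ℝ) := by push_cast at h4 ⊢; linarith
      have h6 : ((m - i : ℤ) : ℝ) < 1 := by push_cast at h4 ⊢; linarith
      have h7 : 0 < (m - i : ℤ) := by exact_mod_cast h5
      have h8 : (m - i : ℤ) < 1 := by exact_mod_cast h6
      omega
    have hc : (r.choose (m + 1) : ℝ) * (m + 1) = r.choose m * (r - m) := by
      have := Nat.choose_succ_right_eq r m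
      rw [← Nat.cast_sub (by omega)]
      exact_mod_cast this
    have hm1 : (m : ℝ) + 1 ≠ 0 := by positivity
    have hh : hypCoeff s r (m + 1) * (m + 1) = hypCoeff s r m * ((r - m) * ((r + s - m) / (1 - s + m))) := by
      unfold hypCoeff
      rw [Finset.prod_range_succ]
      linear_combination ((∏ i ∈ Finset.range m, ((r + s - i) / (1 - s + i))) *
        ((r + s - m) / (1 - s + m))) * hc
    apply mul_right_cancel₀ hm1
    rw [hh, ← ih]
    have q : (∏ i ∈ Finset.range (r + 1), (s - (m + 1 : ℕ) + (i : ℝ)))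
        = (∏ i ∈ Finset.range (r + 1), (s - m + i)) * (s - (m + 1)) / (s - m + r) := by
      rw [e1]; field_simp
    rw [q]
    have := d4 m
    rw [pow_succ, show s - (m + 1) = -(1 - s + m) by ring, show (r : ℝ) + s - m = s - m + r by ring]
    field_simp
    linear_combination hc

/-! ### The Padé remainder as an integral, and its size -/

lemma one_sub_pow_eq_sum (x : ℂ) (r : ℕ) :
    (1 - x) ^ r = ∑ j ∈ Finset.range (r + 1), (-1) ^ j * (r.choose j : ℂ) * x ^ j := by
  rw [sub_eq_neg_add, add_pow]
  refine Finset.sum_congr rfl fun j _ => ?_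
  rw [neg_pow]; ring

lemma integral_mul_exp (c w : ℂ) (hc : c ≠ 0) :
    ∫ v in (0 : ℝ)..1, w * Complex.exp (c * w * v) = (Complex.exp (c * w) - 1) / c := by
  rcases eq_or_ne w 0 with rfl | hw
  · simp
  rw [intervalIntegral.integral_const_mul, integral_exp_mul_complex (mul_ne_zero hc hw)]
  simp
  field_simp

/-- The remainder of the Padé approximation of `exp (s * w)` by hypergeometric polynomials in
`exp w`, as an integral. -/
lemma hyp_remainder_eq_integral {s : ℝ} (h0 : 0 < s) (h1 : s < 1) (r : ℕ) (w : ℂ) :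
    Complex.exp (s * w) * ∑ k ∈ Finset.range (r + 1), (hypCoeff s r k : ℂ) * Complex.exp w ^ (r - k)
      - ∑ k ∈ Finset.range (r + 1), (hypCoeff s r k : ℂ) * Complex.exp w ^ k
    = (((∏ i ∈ Finset.range (r + 1), (s + i)) / r.factorial : ℝ) : ℂ) *
      ∫ v in (0 : ℝ)..1, w * ((1 - Complex.exp (v * w)) * (1 - Complex.exp (w - v * w))) ^ r
        * Complex.exp (s * v * w) := by
  -- As `s` lies strictly between `0` and `1` it is not an integer, so every denominator arising
  -- from integrating the expanded kernel is nonzero.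
  have hne : ∀ j m : ℕ, (s : ℂ) - j + m ≠ 0 := by
    intro j m h
    have h4 : s - j + m = 0 := by exact_mod_cast h
    have h5 : (0 : ℝ) < ((j - m : ℤ) : ℝ) := by push_cast; linarith
    have h6 : ((j - m : ℤ) : ℝ) < 1 := by push_cast; linarith
    have h7 : 0 < (j - m : ℤ) := by exact_mod_cast h5
    have h8 : (j - m : ℤ) < 1 := by exact_mod_cast h6
    omega
  have hint : ∀ v : ℝ, w * ((1 - Complex.exp (v * w)) * (1 - Complex.exp (w - v * w))) ^ r
        * Complex.exp (s * v * w)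
      = ∑ j ∈ Finset.range (r + 1), ∑ m ∈ Finset.range (r + 1),
        ((-1) ^ j * (r.choose j : ℂ)) * ((-1) ^ m * (r.choose m : ℂ)) * Complex.exp (m * w) *
          (w * Complex.exp ((s - m + j) * w * v)) := by
    intro v
    rw [mul_pow, one_sub_pow_eq_sum, one_sub_pow_eq_sum, Finset.sum_mul_sum, Finset.mul_sum,
      Finset.sum_mul]
    refine Finset.sum_congr rfl fun j _ => ?_
    rw [Finset.mul_sum, Finset.sum_mul]
    refine Finset.sum_congr rfl fun m _ => ?_
    rw [← Complex.exp_nat_mul, ← Complex.exp_nat_mul]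
    have : Complex.exp (j * (v * w)) * Complex.exp (m * (w - v * w)) * Complex.exp (s * v * w)
        = Complex.exp (m * w) * Complex.exp ((s - m + j) * w * v) := by
      rw [← Complex.exp_add, ← Complex.exp_add, ← Complex.exp_add]; congr 1; ring
    linear_combination w * ((-1) ^ j * (r.choose j : ℂ)) * ((-1) ^ m * (r.choose m : ℂ)) * this
  have hI : ∫ v in (0 : ℝ)..1, w * ((1 - Complex.exp (v * w)) * (1 - Complex.exp (w - v * w))) ^ r
        * Complex.exp (s * v * w)
      = ∑ j ∈ Finset.range (r + 1), ∑ m ∈ Finset.range (r + 1),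
        ((-1) ^ j * (r.choose j : ℂ)) * ((-1) ^ m * (r.choose m : ℂ)) * Complex.exp (m * w) *
          ((Complex.exp ((s - m + j) * w) - 1) / (s - m + j)) := by
    simp_rw [hint]
    rw [intervalIntegral.integral_finsetSum]
    · refine Finset.sum_congr rfl fun j _ => ?_
      rw [intervalIntegral.integral_finsetSum]
      · refine Finset.sum_congr rfl fun m _ => ?_
        rw [intervalIntegral.integral_const_mul, integral_mul_exp _ _ (hne m j)]
      · intro m _
        exact Continuous.intervalIntegrable (by fun_prop) _ _
    · intro j _
      exact Continuous.intervalIntegrable (by fun_prop) _ _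
  have hX : ∀ m ∈ Finset.range (r + 1), (hypCoeff s r m : ℂ)
      = (((∏ i ∈ Finset.range (r + 1), (s + i)) / r.factorial : ℝ) : ℂ) * ((-1) ^ m * (r.choose m : ℂ)
        * ∑ j ∈ Finset.range (r + 1), (-1) ^ j * (r.choose j : ℂ) / (s - m + j)) := by
    intro m hm
    rw [sum_neg_one_pow_choose_div r _ fun i _ => hne m i,
      ← prod_mul_choose_div_prod h0 h1 (Nat.lt_succ_iff.1 (Finset.mem_range.1 hm))]
    have : (r.factorial : ℂ) ≠ 0 := by exact_mod_cast r.factorial_ne_zero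
    push_cast
    field_simp
  rw [hI]
  have hsplit : ∑ j ∈ Finset.range (r + 1), ∑ m ∈ Finset.range (r + 1),
        ((-1) ^ j * (r.choose j : ℂ)) * ((-1) ^ m * (r.choose m : ℂ)) * Complex.exp (m * w) *
          ((Complex.exp ((s - m + j) * w) - 1) / (s - m + j))
      = Complex.exp (s * w) * (∑ m ∈ Finset.range (r + 1), ((-1) ^ m * (r.choose m : ℂ)
        * ∑ j ∈ Finset.range (r + 1), (-1) ^ j * (r.choose j : ℂ) / (s - m + j)) *
          Complex.exp w ^ (r - m))
        - ∑ m ∈ Finset.range (r + 1), ((-1) ^ m * (r.choose m : ℂ)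
        * ∑ j ∈ Finset.range (r + 1), (-1) ^ j * (r.choose j : ℂ) / (s - m + j)) *
          Complex.exp w ^ m := by
    -- Contribution of the endpoint `v = 1`: reversing both indices exchanges the roles of `j` and
    -- `m` and produces the reciprocal polynomial. The endpoint `v = 0`, treated in `hB`, gives the
    -- polynomial itself.
    have hA : ∑ j ∈ Finset.range (r + 1), ∑ m ∈ Finset.range (r + 1),
        ((-1) ^ j * (r.choose j : ℂ)) * ((-1) ^ m * (r.choose m : ℂ)) * Complex.exp (m * w) *
          (Complex.exp ((s - m + j) * w) / (s - m + j))
        = Complex.exp (s * w) * (∑ m ∈ Finset.range (r + 1), ((-1) ^ m * (r.choose m : ℂ)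
        * ∑ j ∈ Finset.range (r + 1), (-1) ^ j * (r.choose j : ℂ) / (s - m + j)) *
          Complex.exp w ^ (r - m)) := by
      rw [← Finset.sum_range_reflect, Finset.mul_sum]
      refine Finset.sum_congr rfl fun j hj => ?_
      have hj' : j ≤ r := by simpa [Nat.lt_succ_iff] using hj
      rw [← Finset.sum_range_reflect, Finset.mul_sum, Finset.sum_mul, Finset.mul_sum]
      refine Finset.sum_congr rfl fun m hm => ?_
      have hm' : m ≤ r := by simpa [Nat.lt_succ_iff] using hm
      rw [show r + 1 - 1 - j = r - j by omega, show r + 1 - 1 - m = r - m by omega,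
        Nat.choose_symm hj', Nat.choose_symm hm', ← Complex.exp_nat_mul]
      have e1 : ((-1 : ℂ)) ^ (r - j) * (-1) ^ (r - m) = (-1) ^ j * (-1) ^ m := by
        rw [← pow_add, ← pow_add]
        refine neg_one_pow_congr ?_
        rw [Nat.even_add, Nat.even_add, Nat.even_sub hj', Nat.even_sub hm']
        tauto
      have e2 : (s : ℂ) - (r - m : ℕ) + (r - j : ℕ) = s - j + m := by
        push_cast [hj', hm']; ring
      rw [e2]
      have e3 : Complex.exp ((r - m : ℕ) * w) * Complex.exp ((s - j + m) * w)
          = Complex.exp (s * w) * Complex.exp ((r - j : ℕ) * w) := by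
        rw [← Complex.exp_add, ← Complex.exp_add]; congr 1
        push_cast [hj', hm']; ring
      linear_combination ((-1) ^ (r - j) * (-1) ^ (r - m) * (r.choose j : ℂ) * (r.choose m : ℂ) /
        (s - j + m)) * e3 + (r.choose j : ℂ) * (r.choose m : ℂ) / (s - j + m) *
        (Complex.exp (s * w) * Complex.exp ((r - j : ℕ) * w)) * e1
    have hB : ∑ j ∈ Finset.range (r + 1), ∑ m ∈ Finset.range (r + 1),
        ((-1) ^ j * (r.choose j : ℂ)) * ((-1) ^ m * (r.choose m : ℂ)) * Complex.exp (m * w) *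
          (1 / (s - m + j))
        = ∑ m ∈ Finset.range (r + 1), ((-1) ^ m * (r.choose m : ℂ)
        * ∑ j ∈ Finset.range (r + 1), (-1) ^ j * (r.choose j : ℂ) / (s - m + j)) *
          Complex.exp w ^ m := by
      rw [Finset.sum_comm]
      refine Finset.sum_congr rfl fun m hm => ?_
      rw [Finset.mul_sum, Finset.sum_mul]
      refine Finset.sum_congr rfl fun j hj => ?_
      rw [Complex.exp_nat_mul]
      ring
    rw [← hA, ← hB, ← Finset.sum_sub_distrib]
    refine Finset.sum_congr rfl fun j _ => ?_
    rw [← Finset.sum_sub_distrib]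
    refine Finset.sum_congr rfl fun m _ => ?_
    ring
  rw [hsplit, mul_sub, Finset.mul_sum, mul_left_comm]
  congr 1
  · rw [← Finset.mul_sum]
    congr 1
    rw [Finset.mul_sum]
    refine Finset.sum_congr rfl fun m hm => ?_
    rw [hX m hm]; ring
  · rw [Finset.mul_sum]
    refine Finset.sum_congr rfl fun m hm => ?_
    rw [hX m hm]; ring

/-- The logarithms which are positive real or lie on the open segment
`(-iπ, iπ)`. -/
def IsRealOrCircleLog (w : ℂ) : Prop :=
  (∃ x : ℝ, 0 < x ∧ w = x) ∨ ∃ x : ℝ, |x| < Real.pi ∧ w = x * Complex.I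

lemma IsRealOrCircleLog.re_nonneg {w : ℂ} (hw : IsRealOrCircleLog w) : 0 ≤ w.re := by
  rcases hw with ⟨x, hx, rfl⟩ | ⟨x, hx, rfl⟩
  · simpa using hx.le
  · simp

/-- On the real line `cosh` increases with the absolute value of its argument; on the imaginary
segment it becomes `cos`, which is decreasing on `[0, π/2]`. In both cases the difference is
extremal at `u = 0`. -/
lemma IsRealOrCircleLog.norm_cosh_sub_le {w : ℂ} (hw : IsRealOrCircleLog w) {u : ℝ}
    (hu : |u| ≤ 1 / 2) :
    ‖Complex.cosh (w / 2) - Complex.cosh (u * w)‖ ≤ ‖Complex.cosh (w / 2) - 1‖ := by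
  rcases hw with ⟨x, hx, rfl⟩ | ⟨x, hx, rfl⟩
  · rw [show (x : ℂ) / 2 = ((x / 2 : ℝ) : ℂ) by push_cast; rfl, ← Complex.ofReal_mul,
      ← Complex.ofReal_cosh, ← Complex.ofReal_cosh, ← Complex.ofReal_one, ← Complex.ofReal_sub,
      ← Complex.ofReal_sub, Complex.norm_real, Complex.norm_real, Real.norm_eq_abs,
      Real.norm_eq_abs]
    have h1 : Real.cosh (u * x) ≤ Real.cosh (x / 2) := by
      rw [Real.cosh_le_cosh, abs_mul, abs_of_pos hx, abs_of_pos (half_pos hx)]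
      nlinarith
    have h2 := Real.one_le_cosh (u * x)
    rw [abs_of_nonneg (by linarith), abs_of_nonneg (by linarith)]
    linarith
  · rw [show (x : ℂ) * Complex.I / 2 = ((x / 2 : ℝ) : ℂ) * Complex.I by push_cast; ring,
      ← mul_assoc, ← Complex.ofReal_mul, Complex.cosh_mul_I, Complex.cosh_mul_I,
      ← Complex.ofReal_cos, ← Complex.ofReal_cos, ← Complex.ofReal_one, ← Complex.ofReal_sub,
      ← Complex.ofReal_sub, Complex.norm_real, Complex.norm_real, Real.norm_eq_abs,
      Real.norm_eq_abs]
    have h1 : Real.cos (x / 2) ≤ Real.cos (u * x) := by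
      rw [← Real.cos_abs (x / 2), ← Real.cos_abs (u * x)]
      have e : |u * x| ≤ |x / 2| := by
        rw [abs_mul, abs_div, abs_two]
        nlinarith [abs_nonneg x]
      refine Real.cos_le_cos_of_nonneg_of_le_pi (abs_nonneg _) ?_ e
      rw [abs_div, abs_two]
      linarith [abs_nonneg x]
    have h2 := Real.cos_le_one (u * x)
    rw [abs_of_nonpos (by linarith), abs_of_nonpos (by linarith)]
    linarith

/-- This form displays the symmetry of the kernel about `v = 1/2`; the value there is `(exp (w/2) -
1)^2`, up to sign. -/
lemma exp_half_mul_cosh_sub (w : ℂ) (v : ℂ) :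
    (1 - Complex.exp (v * w)) * (1 - Complex.exp (w - v * w))
      = 2 * Complex.exp (w / 2) * (Complex.cosh (w / 2) - Complex.cosh ((v - 1 / 2) * w)) := by
  have e1 : Complex.exp (v * w) = Complex.exp (w / 2) * Complex.exp ((v - 1 / 2) * w) := by
    rw [← Complex.exp_add]; congr 1; ring
  have e2 : Complex.exp (w - v * w) = Complex.exp (w / 2) * Complex.exp (-((v - 1 / 2) * w)) := by
    rw [← Complex.exp_add]; congr 1; ring
  have e3 : Complex.exp ((v - 1 / 2) * w) * Complex.exp (-((v - 1 / 2) * w)) = 1 := by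
    rw [← Complex.exp_add]; simp
  have e4 : Complex.exp (w / 2) * Complex.exp (-(w / 2)) = 1 := by
    rw [← Complex.exp_add]; simp
  rw [e1, e2, Complex.cosh, Complex.cosh]
  linear_combination Complex.exp (w / 2) ^ 2 * e3 - e4

lemma sq_exp_half_sub_one (w : ℂ) :
    (Complex.exp (w / 2) - 1) ^ 2 = 2 * Complex.exp (w / 2) * (Complex.cosh (w / 2) - 1) := by
  have e4 : Complex.exp (w / 2) * Complex.exp (-(w / 2)) = 1 := by
    rw [← Complex.exp_add]; simp
  rw [Complex.cosh]
  linear_combination -e4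

lemma IsRealOrCircleLog.norm_kernel_le {w : ℂ} (hw : IsRealOrCircleLog w) {v : ℝ} (h0 : 0 ≤ v)
    (h1 : v ≤ 1) :
    ‖(1 - Complex.exp (v * w)) * (1 - Complex.exp (w - v * w))‖
      ≤ ‖Complex.exp (w / 2) - 1‖ ^ 2 := by
  rw [← norm_pow, sq_exp_half_sub_one, exp_half_mul_cosh_sub,
    norm_mul (2 * _) (_ - Complex.cosh _), norm_mul (2 * _) (_ - 1)]
  refine mul_le_mul_of_nonneg_left ?_ (norm_nonneg _)
  have := hw.norm_cosh_sub_le (u := v - 1 / 2) (abs_le.2 ⟨by linarith, by linarith⟩)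
  simpa using this

lemma IsRealOrCircleLog.norm_le {w : ℂ} (hw : IsRealOrCircleLog w) :
    ‖w‖ ≤ 2 * ‖Complex.exp w - 1‖ := by
  rcases hw with ⟨x, hx, rfl⟩ | ⟨x, hx, rfl⟩
  · rw [← Complex.ofReal_exp, ← Complex.ofReal_one, ← Complex.ofReal_sub, Complex.norm_real,
      Complex.norm_real, Real.norm_eq_abs, Real.norm_eq_abs, abs_of_pos hx]
    have := Real.add_one_le_exp x
    rw [abs_of_nonneg (by linarith)]
    linarith
  · rw [mul_comm (x : ℂ), Complex.norm_exp_I_mul_ofReal_sub_one, norm_mul, Complex.norm_I, one_mul,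
      Complex.norm_real, Real.norm_eq_abs, Real.norm_eq_abs, abs_mul, abs_two]
    -- Jordan's inequality for the chord `2 |sin (x/2)|`; the crude bound `π ≤ 4` then yields the
    -- constant `2`.
    have h := Real.mul_abs_le_abs_sin (x := x / 2) (by rw [abs_div, abs_two]; linarith)
    rw [abs_div, abs_two] at h
    have hp : 1 / 2 ≤ 2 / Real.pi := by
      rw [div_le_div_iff₀ (by norm_num) Real.pi_pos]; linarith [Real.pi_le_four]
    have := mul_le_mul_of_nonneg_right hp (a := |x| / 2) (by positivity)
    linarith

lemma norm_hyp_remainder_le {s : ℝ} (h0 : 0 < s) (h1 : s < 1) (r : ℕ) {w : ℂ}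
    (hw : IsRealOrCircleLog w) :
    ‖Complex.exp (s * w) *
        ∑ k ∈ Finset.range (r + 1), (hypCoeff s r k : ℂ) * Complex.exp w ^ (r - k)
      - ∑ k ∈ Finset.range (r + 1), (hypCoeff s r k : ℂ) * Complex.exp w ^ k‖
    ≤ (∏ i ∈ Finset.range (r + 1), (s + i)) / r.factorial *
      (2 * ‖Complex.exp w - 1‖ * ‖Complex.exp w‖ * (‖Complex.exp (w / 2) - 1‖ ^ 2) ^ r) := by
  rw [hyp_remainder_eq_integral h0 h1, norm_mul, Complex.norm_real, Real.norm_of_nonneg (by positivity)]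
  refine mul_le_mul_of_nonneg_left ?_ (by positivity)
  refine (intervalIntegral.norm_integral_le_of_norm_le_const
    (C := 2 * ‖Complex.exp w - 1‖ * ‖Complex.exp w‖ * (‖Complex.exp (w / 2) - 1‖ ^ 2) ^ r)
    fun v hv => ?_).trans (by simp)
  rw [Set.uIoc_of_le zero_le_one] at hv
  rw [norm_mul, norm_mul, norm_pow]
  have hk := hw.norm_kernel_le hv.1.le hv.2
  -- The weight has exponent `s v ≤ 1`, and `Re w ≥ 0`.
  have he : ‖Complex.exp (s * v * w)‖ ≤ ‖Complex.exp w‖ := by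
    rw [Complex.norm_exp, Complex.norm_exp, Real.exp_le_exp, ← Complex.ofReal_mul,
      Complex.re_ofReal_mul]
    have : s * v ≤ 1 := mul_le_one₀ h1.le hv.1.le hv.2
    nlinarith [hw.re_nonneg]
  calc _ ≤ 2 * ‖Complex.exp w - 1‖ * (‖Complex.exp (w / 2) - 1‖ ^ 2) ^ r * ‖Complex.exp w‖ := by
        gcongr
        exact hw.norm_le
    _ = _ := by ring

/-! ### Gamma and binomial identities, and the size of the polynomials -/

lemma Gamma_add_natCast_eq_prod {s : ℝ} (hs : 0 < s) (k : ℕ) :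
    Real.Gamma (s + k) = (∏ i ∈ Finset.range k, (s + i)) * Real.Gamma s := by
  induction k with
  | zero => simp
  | succ k ih =>
    rw [Nat.cast_succ, ← add_assoc, Real.Gamma_add_one (by positivity), ih, Finset.prod_range_succ]
    ring

lemma ringChoose_eq_prod (x : ℝ) (k : ℕ) :
    Ring.choose x k = (∏ i ∈ Finset.range k, (x - i)) / k.factorial := by
  have h : ∀ k : ℕ, (descPochhammer ℝ k).eval x = ∏ i ∈ Finset.range k, (x - i) := by
    intro k
    induction k with
    | zero => simp
    | succ k ih => rw [descPochhammer_succ_eval, ih, Finset.prod_range_succ]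
  rw [Ring.choose_eq_smul, ← h, ← descPochhammer_map (Int.castRingHom ℝ), Polynomial.eval_map,
    Polynomial.eval₂_eq_sum_range, Polynomial.smeval_eq_sum, Polynomial.sum_over_range]
  · simp [Polynomial.smul_pow, div_eq_inv_mul]
  · simp [Polynomial.smul_pow]

/-- The normalizing factor `r! / (1 - s)_r`. -/
def hypFactor (s : ℝ) (r : ℕ) : ℝ := r.factorial / ∏ i ∈ Finset.range r, (1 - s + i)

lemma hypFactor_pos {s : ℝ} (h1 : s < 1) (r : ℕ) : 0 < hypFactor s r := by
  refine div_pos (by positivity) (Finset.prod_pos fun i _ => ?_)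
  have : (0 : ℝ) ≤ i := i.cast_nonneg
  linarith

/-- Up to `hypFactor`, this makes the polynomial at `z` the coefficient of `T^r` in `(1 + zT)^(r+s)
(1 + T)^(r-s)`, which serves both size estimates. -/
lemma hypCoeff_eq_choose_mul_choose {s : ℝ} (h1 : s < 1) {r k : ℕ} (hk : k ≤ r) :
    hypCoeff s r k = hypFactor s r * (Ring.choose (r + s) k * Ring.choose (r - s) (r - k)) := by
  have hp : ∏ i ∈ Finset.range r, (1 - s + i)
      = (∏ i ∈ Finset.range k, (1 - s + i)) * ∏ i ∈ Finset.range (r - k), ((r : ℝ) - s - i) := by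
    obtain ⟨m, rfl⟩ := Nat.exists_eq_add_of_le hk
    rw [Finset.prod_range_add]
    congr 1
    rw [Nat.add_sub_cancel_left, ← Finset.prod_range_reflect]
    refine Finset.prod_congr rfl fun i hi => ?_
    have : i + 1 ≤ m := Finset.mem_range.1 hi
    rw [show m - 1 - i = m - (i + 1) by omega]
    push_cast [this]
    ring
  have n0 : ∏ i ∈ Finset.range r, (1 - s + (i : ℝ)) ≠ 0 :=
    (Finset.prod_pos fun i _ => by
      have : (0 : ℝ) ≤ i := i.cast_nonneg
      linarith).ne'
  have n1 := n0
  rw [hp] at n1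
  have n2 := left_ne_zero_of_mul n1
  have n3 := right_ne_zero_of_mul n1
  have hc : (r.choose k : ℝ) * (k.factorial * (r - k).factorial) = r.factorial := by
    rw [← mul_assoc]; exact_mod_cast Nat.choose_mul_factorial_mul_factorial hk
  rw [hypFactor, hypCoeff, ringChoose_eq_prod, ringChoose_eq_prod, hp, Finset.prod_div_distrib, ← hc]
  have f1 : (k.factorial : ℝ) ≠ 0 := by positivity
  have f2 : ((r - k).factorial : ℝ) ≠ 0 := by positivity
  field_simp

lemma abs_ringChoose_neg_le {s : ℝ} (h0 : 0 < s) (h1 : s < 1) (k : ℕ) :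
    |Ring.choose (-s) k| ≤ 1 := by
  rw [ringChoose_eq_prod]
  induction k with
  | zero => simp
  | succ k ih =>
    rw [Finset.prod_range_succ, Nat.factorial_succ, Nat.cast_mul, mul_comm ((k + 1 : ℕ) : ℝ),
      mul_div_mul_comm, abs_mul]
    refine mul_le_one₀ ih (abs_nonneg _) ?_
    push_cast
    have : (0 : ℝ) ≤ k := k.cast_nonneg
    rw [abs_div, abs_of_neg (by linarith), abs_of_pos (by linarith), div_le_one (by linarith)]
    linarith

lemma abs_ringChoose_succ {s : ℝ} (h0 : 0 < s) (h1 : s < 1) (k : ℕ) :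
    |Ring.choose s (k + 1)| = s / (k + 1) * ∏ i ∈ Finset.range k, (1 - s / (i + 1)) := by
  rw [ringChoose_eq_prod]
  induction k with
  | zero => simp [abs_of_pos h0]
  | succ k ih =>
    rw [Finset.prod_range_succ, Nat.factorial_succ, Nat.cast_mul, mul_comm ((k + 1 + 1 : ℕ) : ℝ),
      mul_div_mul_comm, abs_mul, ih, Finset.prod_range_succ (fun i : ℕ => 1 - s / ((i : ℝ) + 1))]
    have : (0 : ℝ) ≤ k := k.cast_nonneg
    push_cast
    rw [abs_div, abs_of_neg (by linarith), abs_of_pos (by linarith)]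
    field_simp
    ring

/-- The partial sums telescope to `2` minus a product of numbers in `[0, 1]`. -/
lemma sum_abs_ringChoose_le {s : ℝ} (h0 : 0 < s) (h1 : s < 1) (k : ℕ) :
    ∑ i ∈ Finset.range (k + 1), |Ring.choose s i| ≤ 2 := by
  have h : ∀ k : ℕ, ∑ i ∈ Finset.range (k + 1), |Ring.choose s i|
      = 2 - ∏ i ∈ Finset.range k, (1 - s / (i + 1)) := by
    intro k
    induction k with
    | zero => simp; norm_num
    | succ k ih =>
      rw [Finset.sum_range_succ, ih, abs_ringChoose_succ h0 h1, Finset.prod_range_succ]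
      ring
  rw [h, sub_le_self_iff]
  refine Finset.prod_nonneg fun i _ => ?_
  rw [sub_nonneg, div_le_one (by positivity)]
  have : (0 : ℝ) ≤ i := i.cast_nonneg
  linarith

lemma norm_coeff_rescale_binomialSeries_mul_le {s : ℝ} (h0 : 0 < s) (h1 : s < 1) {z : ℂ}
    (hz : ‖z‖ ≤ 1) (k : ℕ) :
    ‖PowerSeries.coeff k (PowerSeries.rescale z (PowerSeries.binomialSeries ℂ s) *
      PowerSeries.binomialSeries ℂ (-s))‖ ≤ 2 := by
  rw [PowerSeries.coeff_mul]
  refine (norm_sum_le _ _).trans ?_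
  rw [Finset.Nat.sum_antidiagonal_eq_sum_range_succ_mk]
  refine (Finset.sum_le_sum fun i hi => ?_).trans (sum_abs_ringChoose_le h0 h1 k)
  simp only [PowerSeries.coeff_rescale, PowerSeries.binomialSeries_coeff, norm_mul, norm_pow,
    norm_smul, norm_one, mul_one, Real.norm_eq_abs]
  have a1 := abs_ringChoose_neg_le h0 h1 (k - i)
  have a2 : ‖z‖ ^ i ≤ 1 := pow_le_one₀ (norm_nonneg _) hz
  calc ‖z‖ ^ i * |Ring.choose s i| * |Ring.choose (-s) (k - i)|
      ≤ 1 * |Ring.choose s i| * 1 := by gcongr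
    _ = _ := by ring

lemma norm_coeff_X_mul_le {f : PowerSeries ℂ} {M : ℝ} (hM : ∀ k, ‖PowerSeries.coeff k f‖ ≤ M)
    (k : ℕ) : ‖PowerSeries.coeff k (PowerSeries.X * f)‖ ≤ M := by
  cases k with
  | zero => simpa using (norm_nonneg _).trans (hM 0)
  | succ k => simpa [PowerSeries.coeff_succ_X_mul] using hM k

/-- Multiplication by a polynomial enlarges a uniform coefficient bound by at most the sum of the
absolute values of its coefficients. -/
lemma norm_coeff_quadratic_pow_mul_le (β γ : ℂ) {f : PowerSeries ℂ} {M : ℝ}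
    (hM : ∀ k, ‖PowerSeries.coeff k f‖ ≤ M) (r k : ℕ) :
    ‖PowerSeries.coeff k ((1 + PowerSeries.C β * PowerSeries.X
      + PowerSeries.C γ * PowerSeries.X ^ 2) ^ r * f)‖ ≤ (1 + ‖β‖ + ‖γ‖) ^ r * M := by
  induction r generalizing k with
  | zero => simpa using hM k
  | succ r ih =>
    have h1 := norm_coeff_X_mul_le ih
    have h2 := norm_coeff_X_mul_le h1
    set g := (1 + PowerSeries.C β * PowerSeries.X + PowerSeries.C γ * PowerSeries.X ^ 2) ^ r * f
      with hg
    rw [show (1 + PowerSeries.C β * PowerSeries.X + PowerSeries.C γ * PowerSeries.X ^ 2) ^ (r + 1) * f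
      = g + PowerSeries.C β * (PowerSeries.X * g)
        + PowerSeries.C γ * (PowerSeries.X * (PowerSeries.X * g)) by rw [hg]; ring,
      map_add, map_add, PowerSeries.coeff_C_mul, PowerSeries.coeff_C_mul]
    refine (norm_add₃_le).trans ?_
    rw [norm_mul, norm_mul]
    calc _ ≤ (1 + ‖β‖ + ‖γ‖) ^ r * M + ‖β‖ * ((1 + ‖β‖ + ‖γ‖) ^ r * M)
          + ‖γ‖ * ((1 + ‖β‖ + ‖γ‖) ^ r * M) := by
          gcongr
          · exact ih k
          · exact h1 k
          · exact h2 k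
      _ = _ := by ring

lemma sum_hypCoeff_mul_pow_eq_coeff {s : ℝ} (h1 : s < 1) (r : ℕ) (z : ℂ) :
    ∑ k ∈ Finset.range (r + 1), (hypCoeff s r k : ℂ) * z ^ k
      = hypFactor s r * PowerSeries.coeff r ((1 + PowerSeries.C (1 + z) * PowerSeries.X
      + PowerSeries.C z * PowerSeries.X ^ 2) ^ r * (PowerSeries.rescale z
        (PowerSeries.binomialSeries ℂ s) * PowerSeries.binomialSeries ℂ (-s))) := by
  have e : (1 + PowerSeries.C (1 + z) * PowerSeries.X
      + PowerSeries.C z * PowerSeries.X ^ 2) ^ r * (PowerSeries.rescale z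
        (PowerSeries.binomialSeries ℂ s) * PowerSeries.binomialSeries ℂ (-s))
      = PowerSeries.rescale z (PowerSeries.binomialSeries ℂ ((r : ℝ) + s))
        * PowerSeries.binomialSeries ℂ ((r : ℝ) - s) := by
    rw [sub_eq_add_neg, PowerSeries.binomialSeries_add, PowerSeries.binomialSeries_add,
      PowerSeries.binomialSeries_nat, map_mul, map_pow, map_add, map_one, map_add, map_one, PowerSeries.rescale_X]
    rw [show (1 : PowerSeries ℂ) + (1 + PowerSeries.C z) * PowerSeries.X
      + PowerSeries.C z * PowerSeries.X ^ 2 = (1 + PowerSeries.C z * PowerSeries.X) *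
        (1 + PowerSeries.X) by ring, mul_pow]
    ring
  rw [e, PowerSeries.coeff_mul, Finset.Nat.sum_antidiagonal_eq_sum_range_succ_mk, Finset.mul_sum]
  refine Finset.sum_congr rfl fun k hk => ?_
  rw [hypCoeff_eq_choose_mul_choose h1 (by simpa [Nat.lt_succ_iff] using hk)]
  simp only [PowerSeries.coeff_rescale, PowerSeries.binomialSeries_coeff]
  rw [Complex.real_smul, Complex.real_smul]
  push_cast
  ring

/-- On the unit circle the crude coefficient bound loses nothing: `|1 + ζ²| = 2 Re ζ`, so `1 + |1 +
ζ²| + |ζ²| = 2 + 2 Re ζ = |1 + ζ|²`. -/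
lemma norm_sum_hypCoeff_mul_pow_le_of_norm_eq_one {s : ℝ} (h0 : 0 < s) (h1 : s < 1) (r : ℕ) {ζ : ℂ}
    (hζ : ‖ζ‖ = 1) (hre : 0 ≤ ζ.re) :
    ‖∑ k ∈ Finset.range (r + 1), (hypCoeff s r k : ℂ) * (ζ ^ 2) ^ k‖
      ≤ hypFactor s r * (2 * (‖1 + ζ‖ ^ 2) ^ r) := by
  rw [sum_hypCoeff_mul_pow_eq_coeff h1, norm_mul, Complex.norm_real,
    Real.norm_of_nonneg (hypFactor_pos h1 r).le]
  refine mul_le_mul_of_nonneg_left ?_ (hypFactor_pos h1 r).le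
  refine (norm_coeff_quadratic_pow_mul_le _ _ (norm_coeff_rescale_binomialSeries_mul_le h0 h1
    (by rw [norm_pow, hζ, one_pow])) r r).trans_eq ?_
  rw [mul_comm]
  congr 2
  have h2 : ζ.re ^ 2 + ζ.im ^ 2 = 1 := by
    have := Complex.sq_norm ζ
    rw [hζ, Complex.normSq_apply] at this
    linarith
  have h3 : ‖1 + ζ ^ 2‖ = 2 * ζ.re := by
    rw [← sq_eq_sq₀ (norm_nonneg _) (by positivity), Complex.sq_norm, Complex.normSq_apply]
    simp [pow_two]
    linear_combination (ζ.re ^ 2 + ζ.im ^ 2 + 1) * h2 - 2 * h2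
  rw [h3, norm_pow, hζ, Complex.sq_norm, Complex.normSq_apply]
  simp
  linear_combination -h2

/-- Vandermonde: both sides are `hypFactor` times the coefficient of `T^r` in `(1 + T)^(2r)`,
factored in two ways. -/
lemma sum_hypCoeff {s : ℝ} (h1 : s < 1) (r : ℕ) :
    ∑ k ∈ Finset.range (r + 1), hypCoeff s r k
      = ∑ k ∈ Finset.range (r + 1), hypFactor s r * (r.choose k : ℝ) ^ 2 := by
  have h := Ring.add_choose_eq r (Commute.all ((r : ℝ) + s) (r - s))
  have h' := Ring.add_choose_eq r (Commute.all (r : ℝ) r)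
  rw [show (r : ℝ) + s + (r - s) = r + r by ring, h',
    Finset.Nat.sum_antidiagonal_eq_sum_range_succ_mk,
    Finset.Nat.sum_antidiagonal_eq_sum_range_succ_mk] at h
  rw [← Finset.mul_sum]
  calc _ = hypFactor s r * ∑ k ∈ Finset.range (r + 1),
        Ring.choose ((r : ℝ) + s) k * Ring.choose ((r : ℝ) - s) (r - k) := by
        rw [Finset.mul_sum]
        exact Finset.sum_congr rfl fun k hk =>
          hypCoeff_eq_choose_mul_choose h1 (by simpa [Nat.lt_succ_iff] using hk)
    _ = _ := by
        rw [← h]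
        congr 1
        refine Finset.sum_congr rfl fun k hk => ?_
        have hk' : k ≤ r := by simpa [Nat.lt_succ_iff] using hk
        simp only [Ring.choose_natCast]
        rw [Nat.choose_symm hk', sq]

/-- A sum with total zero whose terms change sign once, from negative to positive, becomes
nonpositive after weighting with the powers of a number in `[0, 1]`. -/
lemma sum_mul_pow_nonpos_of_single_crossing {N : ℕ} {l ρ : ℕ → ℝ} {x : ℝ} (hx0 : 0 ≤ x)
    (hx1 : x ≤ 1) (hl : ∀ k < N, 0 ≤ l k) (hρ : ∀ i j, i ≤ j → j < N → ρ i ≤ ρ j)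
    (h : ∑ k ∈ Finset.range N, l k * ρ k = 0) : ∑ k ∈ Finset.range N, l k * ρ k * x ^ k ≤ 0 := by
  by_cases hK : ∃ K < N, 0 < ρ K
  · classical
    obtain ⟨hKN, hK0⟩ := Nat.find_spec hK
    set K := Nat.find hK
    have hmin : ∀ k < K, ρ k ≤ 0 := fun k hk => by
      have := Nat.find_min hK hk
      push Not at this
      exact this (hk.trans hKN)
    -- `K` is the first index with a positive factor. Subtracting the zero total times `x^K` makes
    -- every term nonpositive.
    have : ∑ k ∈ Finset.range N, l k * ρ k * x ^ k - (∑ k ∈ Finset.range N, l k * ρ k) * x ^ K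
        ≤ 0 := by
      rw [Finset.sum_mul, ← Finset.sum_sub_distrib]
      refine Finset.sum_nonpos fun k hk => ?_
      have hkN := Finset.mem_range.1 hk
      rw [← mul_sub, mul_assoc]
      refine mul_nonpos_of_nonneg_of_nonpos (hl k hkN) ?_
      rcases lt_or_ge k K with h2 | h2
      · exact mul_nonpos_of_nonpos_of_nonneg (hmin k h2)
          (sub_nonneg.2 (pow_le_pow_of_le_one hx0 hx1 h2.le))
      · exact mul_nonpos_of_nonneg_of_nonpos (hK0.le.trans (hρ K k h2 hkN))
          (sub_nonpos.2 (pow_le_pow_of_le_one hx0 hx1 h2))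
    rwa [h, zero_mul, sub_zero] at this
  · push Not at hK
    refine Finset.sum_nonpos fun k hk => ?_
    have hkN := Finset.mem_range.1 hk
    exact mul_nonpos_of_nonpos_of_nonneg
      (mul_nonpos_of_nonneg_of_nonpos (hl k hkN) (hK k hkN)) (pow_nonneg hx0 _)

lemma hypCoeff_succ (s : ℝ) {r k : ℕ} (hk : k ≤ r) :
    hypCoeff s r (k + 1) = hypCoeff s r k * ((r - k) / (k + 1) * ((r + s - k) / (1 - s + k))) := by
  have hc : (r.choose (k + 1) : ℝ) * (k + 1) = r.choose k * (r - k) := by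
    have := Nat.choose_succ_right_eq r k
    rw [← Nat.cast_sub hk]
    exact_mod_cast this
  have hk1 : (k : ℝ) + 1 ≠ 0 := by positivity
  rw [← eq_div_iff hk1] at hc
  rw [hypCoeff, hypCoeff, Finset.prod_range_succ, hc]
  ring

lemma hypCoeff_div_choose_sq_mono {s : ℝ} (h0 : 0 < s) (h1 : s < 1) {r i j : ℕ} (hij : i ≤ j)
    (hj : j ≤ r) :
    hypCoeff s r i / (r.choose i : ℝ) ^ 2 ≤ hypCoeff s r j / (r.choose j : ℝ) ^ 2 := by
  induction j, hij using Nat.le_induction with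
  | base => exact le_rfl
  | succ k hk ih =>
    refine (ih (by omega)).trans ?_
    have hkr : k ≤ r := by omega
    have hc : (r.choose (k + 1) : ℝ) * (k + 1) = r.choose k * (r - k) := by
      have := Nat.choose_succ_right_eq r k
      rw [← Nat.cast_sub hkr]
      exact_mod_cast this
    have hkr' : (k : ℝ) + 1 ≤ r := by exact_mod_cast hj
    have hk0 : (0 : ℝ) ≤ k := k.cast_nonneg
    have hcp : (0 : ℝ) < r.choose k := by exact_mod_cast Nat.choose_pos hkr
    have hpos : 0 < hypCoeff s r k / (r.choose k : ℝ) ^ 2 :=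
      div_pos (hypCoeff_pos h0 h1 hkr) (by positivity)
    have hc' := (eq_div_iff (by positivity : (k : ℝ) + 1 ≠ 0)).2 hc
    have d1 : 0 < (r : ℝ) - k := by linarith
    have d2 : 0 < 1 - s + k := by linarith
    have e : hypCoeff s r (k + 1) / (r.choose (k + 1) : ℝ) ^ 2
        = hypCoeff s r k / (r.choose k : ℝ) ^ 2 *
          (((r + s - k) * (k + 1)) / ((r - k) * (1 - s + k))) := by
      rw [hypCoeff_succ s hkr, hc']
      field_simp
    rw [e]
    refine le_mul_of_one_le_right hpos.le ?_
    rw [one_le_div (by positivity)]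
    nlinarith

/-- Comparison with `∑ (r choose k)² y^k`, `y = x²`: after normalization the totals at `y = 1`
agree, and the ratio of coefficients increases with `k`. So the difference has one sign change and
is nonpositive on `[0, 1]`. -/
lemma sum_hypCoeff_mul_pow_le {s : ℝ} (h0 : 0 < s) (h1 : s < 1) (r : ℕ) {x : ℝ}
    (hx0 : 0 ≤ x) (hx1 : x ≤ 1) :
    ∑ k ∈ Finset.range (r + 1), hypCoeff s r k * (x ^ 2) ^ k
      ≤ hypFactor s r * ((1 + x) ^ 2) ^ r := by
  have hc : ∀ k < r + 1, (0 : ℝ) < (r.choose k : ℝ) ^ 2 := fun k hk => by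
    have : (0 : ℝ) < r.choose k := by exact_mod_cast Nat.choose_pos (Nat.lt_succ_iff.1 hk)
    positivity
  have he : ∀ k ∈ Finset.range (r + 1), (r.choose k : ℝ) ^ 2 *
      (hypCoeff s r k / (r.choose k : ℝ) ^ 2 - hypFactor s r)
      = hypCoeff s r k - hypFactor s r * (r.choose k : ℝ) ^ 2 := fun k hk => by
    have := (hc k (Finset.mem_range.1 hk)).ne'
    rw [mul_sub, mul_comm _ (_ / _), div_mul_cancel₀ _ this, mul_comm (hypFactor s r)]
  have key := sum_mul_pow_nonpos_of_single_crossing (N := r + 1) (x := x ^ 2)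
    (l := fun k => (r.choose k : ℝ) ^ 2)
    (ρ := fun k => hypCoeff s r k / (r.choose k : ℝ) ^ 2 - hypFactor s r)
    (by positivity) (pow_le_one₀ hx0 hx1) (fun k hk => (hc k hk).le)
    (fun i j hij hj => sub_le_sub_right
      (hypCoeff_div_choose_sq_mono h0 h1 hij (Nat.lt_succ_iff.1 hj)) _)
    (by rw [Finset.sum_congr rfl he, Finset.sum_sub_distrib, sum_hypCoeff h1, sub_self])
  rw [Finset.sum_congr rfl fun k hk => by rw [he k hk, sub_mul], Finset.sum_sub_distrib,
    sub_nonpos] at key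
  refine key.trans ?_
  rw [Finset.sum_congr rfl fun k _ => mul_assoc _ _ _, ← Finset.mul_sum]
  refine mul_le_mul_of_nonneg_left ?_ (hypFactor_pos h1 r).le
  calc ∑ k ∈ Finset.range (r + 1), (r.choose k : ℝ) ^ 2 * (x ^ 2) ^ k
      = ∑ k ∈ Finset.range (r + 1), (x ^ k * r.choose k) ^ 2 :=
        Finset.sum_congr rfl fun k _ => by ring
    _ ≤ (∑ k ∈ Finset.range (r + 1), x ^ k * r.choose k) ^ 2 :=
        Finset.sum_sq_le_sq_sum_of_nonneg fun k _ => by positivity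
    _ = ((1 + x) ^ 2) ^ r := by
        rw [← pow_mul, mul_comm 2 r, pow_mul, add_comm 1 x, add_pow]
        simp

/-- The hypergeometric polynomial at `exp (-w)`. -/
lemma norm_sum_hypCoeff_mul_exp_neg_le {s : ℝ} (h0 : 0 < s) (h1 : s < 1) (r : ℕ) {w : ℂ}
    (hw : IsRealOrCircleLog w) :
    ‖∑ k ∈ Finset.range (r + 1), (hypCoeff s r k : ℂ) * Complex.exp (-w) ^ k‖
      ≤ hypFactor s r * (2 * (‖1 + Complex.exp (-(w / 2))‖ ^ 2) ^ r) := by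
  have he : Complex.exp (-w) = Complex.exp (-(w / 2)) ^ 2 := by
    rw [← Complex.exp_nat_mul]; congr 1; push_cast; ring
  rw [he]
  rcases hw with ⟨x, hx, rfl⟩ | ⟨x, hx, rfl⟩
  · have e1 : Complex.exp (-((x : ℂ) / 2)) = (Real.exp (-(x / 2)) : ℂ) := by push_cast; rfl
    have e2 : ∑ k ∈ Finset.range (r + 1), (hypCoeff s r k : ℂ) * ((Real.exp (-(x / 2)) : ℂ) ^ 2) ^ k
        = ((∑ k ∈ Finset.range (r + 1), hypCoeff s r k * (Real.exp (-(x / 2)) ^ 2) ^ k : ℝ) : ℂ) := by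
      push_cast; rfl
    rw [e1, e2, ← Complex.ofReal_one, ← Complex.ofReal_add, Complex.norm_real, Complex.norm_real,
      Real.norm_of_nonneg (by positivity : 0 ≤ 1 + Real.exp (-(x / 2))), Real.norm_of_nonneg
        (Finset.sum_nonneg fun k hk => mul_nonneg
          (hypCoeff_pos h0 h1 (Nat.lt_succ_iff.1 (Finset.mem_range.1 hk))).le (by positivity))]
    refine (sum_hypCoeff_mul_pow_le h0 h1 r (Real.exp_pos _).le
      (Real.exp_le_one_iff.2 (by linarith))).trans ?_
    refine mul_le_mul_of_nonneg_left ?_ (hypFactor_pos h1 r).le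
    have : 0 ≤ ((1 + Real.exp (-(x / 2))) ^ 2) ^ r := by positivity
    linarith
  · have e1 : -((x : ℂ) * Complex.I / 2) = ((-(x / 2) : ℝ) : ℂ) * Complex.I := by push_cast; ring
    rw [e1]
    refine norm_sum_hypCoeff_mul_pow_le_of_norm_eq_one h0 h1 r (Complex.norm_exp_ofReal_mul_I _) ?_
    rw [Complex.exp_ofReal_mul_I_re, Real.cos_neg]
    have := abs_lt.1 hx
    exact Real.cos_nonneg_of_mem_Icc ⟨by linarith, by linarith⟩

/-! ### Nonvanishing of the determinant of consecutive approximations -/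

/-- The polynomial `₂F₁(-r, -r - s; 1 - s; x)` with real coefficients. -/
def hypPoly (s : ℝ) (r : ℕ) : ℝ[X] :=
  ∑ k ∈ Finset.range (r + 1), C (hypCoeff s r k) * X ^ k

/-- The reciprocal of `hypPoly`. -/
def hypPolyRev (s : ℝ) (r : ℕ) : ℝ[X] :=
  ∑ k ∈ Finset.range (r + 1), C (hypCoeff s r k) * X ^ (r - k)

lemma natDegree_hypPoly_le (s : ℝ) (r : ℕ) : (hypPoly s r).natDegree ≤ r :=
  natDegree_sum_le_of_forall_le _ _ fun _ hk => (natDegree_C_mul_X_pow_le _ _).trans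
    (Nat.lt_succ_iff.1 (Finset.mem_range.1 hk))

lemma natDegree_hypPolyRev_le (s : ℝ) (r : ℕ) : (hypPolyRev s r).natDegree ≤ r :=
  natDegree_sum_le_of_forall_le _ _ fun _ _ => (natDegree_C_mul_X_pow_le _ _).trans
    (Nat.sub_le _ _)

lemma aeval_hypPoly (s : ℝ) (r : ℕ) (z : ℂ) :
    aeval z (hypPoly s r) = ∑ k ∈ Finset.range (r + 1), (hypCoeff s r k : ℂ) * z ^ k := by
  simp [hypPoly]

lemma aeval_hypPolyRev (s : ℝ) (r : ℕ) (z : ℂ) :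
    aeval z (hypPolyRev s r) = ∑ k ∈ Finset.range (r + 1), (hypCoeff s r k : ℂ) * z ^ (r - k) := by
  simp [hypPolyRev]

lemma eval_zero_hypPoly (s : ℝ) (r : ℕ) : (hypPoly s r).eval 0 = 1 := by
  rw [hypPoly, eval_finsetSum, Finset.sum_range_succ']
  simp [hypCoeff_zero]

lemma eval_zero_hypPolyRev (s : ℝ) (r : ℕ) : (hypPolyRev s r).eval 0 = hypCoeff s r r := by
  rw [hypPolyRev, eval_finsetSum, Finset.sum_range_succ, Finset.sum_eq_zero]
  · simp
  · intro k hk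
    have : r - k ≠ 0 := by have := Finset.mem_range.1 hk; omega
    simp [this]

lemma hypCoeff_self (s : ℝ) (r : ℕ) :
    hypCoeff s r r = ∏ i ∈ Finset.range r, ((i + 1 + s) / (i + 1 - s)) := by
  rw [hypCoeff, Nat.choose_self, Nat.cast_one, one_mul, Finset.prod_div_distrib,
    Finset.prod_div_distrib, ← Finset.prod_range_reflect]
  congr 1
  · refine Finset.prod_congr rfl fun i hi => ?_
    have : i + 1 ≤ r := Finset.mem_range.1 hi
    rw [show r - 1 - i = r - (i + 1) by omega]
    push_cast [this]
    ring
  · exact Finset.prod_congr rfl fun i _ => by ring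

/-- The difference of these two numbers is the value at `0` of the determinant in `hyp_det_ne_zero`.
-/
lemma hypCoeff_self_lt_succ {s : ℝ} (h0 : 0 < s) (h1 : s < 1) (r : ℕ) :
    hypCoeff s r r < hypCoeff s (r + 1) (r + 1) := by
  have := hypCoeff_pos h0 h1 (le_refl r)
  have hr : (0 : ℝ) ≤ r := r.cast_nonneg
  rw [hypCoeff_self s (r + 1), Finset.prod_range_succ, ← hypCoeff_self]
  refine lt_mul_of_one_lt_right this ?_
  rw [one_lt_div (by linarith)]
  linarith

/-- Letting `x` tend to `1` from the right shows that `1` is a root; one factor is divided out and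
the bound passes to the quotient. -/
lemma X_sub_one_pow_dvd_of_bound {F : ℝ[X]} {m : ℕ} {M : ℝ}
    (h : ∀ x : ℝ, 1 < x → x < 2 → |F.eval x| ≤ M * (x - 1) ^ m) : (X - C 1) ^ m ∣ F := by
  induction m generalizing F with
  | zero => simp
  | succ m ih =>
    have hF : F.eval 1 = 0 := by
      have t1 : Filter.Tendsto (fun x : ℝ => |F.eval x|) (nhdsWithin 1 (Set.Ioi 1))
          (nhds |F.eval 1|) :=
        ((by fun_prop : Continuous fun x : ℝ => |F.eval x|).tendsto 1).mono_left
          nhdsWithin_le_nhds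
      have t2 : Filter.Tendsto (fun x : ℝ => M * (x - 1) ^ (m + 1)) (nhdsWithin 1 (Set.Ioi 1))
          (nhds (M * (1 - 1) ^ (m + 1))) :=
        ((by fun_prop : Continuous fun x : ℝ => M * (x - 1) ^ (m + 1)).tendsto 1).mono_left
          nhdsWithin_le_nhds
      have := le_of_tendsto_of_tendsto t1 t2 (by
        filter_upwards [Ioo_mem_nhdsGT (one_lt_two : (1 : ℝ) < 2)] with x hx
        exact h x hx.1 hx.2)
      simpa using this
    obtain ⟨G, rfl⟩ := dvd_iff_isRoot.2 hF
    rw [pow_succ']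
    refine mul_dvd_mul_left _ (ih fun x hx1 hx2 => ?_)
    have := h x hx1 hx2
    rw [eval_mul, abs_mul, eval_sub, eval_X, eval_C, abs_of_pos (sub_pos.2 hx1), pow_succ'] at this
    refine le_of_mul_le_mul_left ?_ (sub_pos.2 hx1)
    linarith

lemma abs_rpow_mul_hypPolyRev_sub_le {s : ℝ} (h0 : 0 < s) (h1 : s < 1) (r : ℕ) {x : ℝ}
    (hx1 : 1 < x) (hx2 : x < 2) :
    |x ^ s * (hypPolyRev s r).eval x - (hypPoly s r).eval x|
      ≤ (∏ i ∈ Finset.range (r + 1), (s + i)) / r.factorial * 4 * (x - 1) ^ (2 * r + 1) := by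
  have hx0 : 0 < x := by linarith
  have hl := Real.log_pos hx1
  have h := norm_hyp_remainder_le h0 h1 r (w := (Real.log x : ℂ)) (Or.inl ⟨_, hl, rfl⟩)
  have e1 : Complex.exp (Real.log x) = (x : ℂ) := by
    rw [← Complex.ofReal_exp, Real.exp_log hx0]
  have e2 : Complex.exp (s * Real.log x) = ((x ^ s : ℝ) : ℂ) := by
    rw [Real.rpow_def_of_pos hx0, mul_comm]; push_cast; rfl
  have e3 : Complex.exp ((Real.log x : ℂ) / 2) = ((Real.exp (Real.log x / 2) : ℝ) : ℂ) := by
    push_cast; rfl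
  rw [e1, e2, e3, ← aeval_hypPoly, ← aeval_hypPolyRev, ← Complex.coe_algebraMap,
    aeval_algebraMap_apply, aeval_algebraMap_apply, Complex.coe_algebraMap, ← Complex.ofReal_mul,
    ← Complex.ofReal_sub, ← Complex.ofReal_one, ← Complex.ofReal_sub, ← Complex.ofReal_sub,
    Complex.norm_real, Complex.norm_real, Complex.norm_real, Complex.norm_real,
    Real.norm_eq_abs] at h
  refine h.trans ?_
  rw [mul_assoc (_ / _)]
  refine mul_le_mul_of_nonneg_left ?_ (by positivity)
  have hσ1 : 1 ≤ Real.exp (Real.log x / 2) := Real.one_le_exp (by linarith)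
  have hσ2 : Real.exp (Real.log x / 2) ≤ x := by
    calc _ ≤ Real.exp (Real.log x) := Real.exp_le_exp.2 (by linarith)
      _ = x := Real.exp_log hx0
  rw [Real.norm_of_nonneg (by linarith : 0 ≤ x - 1), Real.norm_of_nonneg hx0.le,
    Real.norm_of_nonneg (by linarith : 0 ≤ Real.exp (Real.log x / 2) - 1), ← pow_mul]
  calc _ ≤ 2 * (x - 1) * 2 * (x - 1) ^ (2 * r) := by gcongr
    _ = _ := by ring

lemma X_sub_one_pow_dvd_det {s : ℝ} (h0 : 0 < s) (h1 : s < 1) (r : ℕ) :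
    (X - C 1) ^ (2 * r + 1) ∣ hypPoly s r * hypPolyRev s (r + 1) - hypPoly s (r + 1) * hypPolyRev s r := by
  obtain ⟨B, hB⟩ := (isCompact_Icc (a := (1 : ℝ)) (b := 2)).exists_bound_of_continuousOn
    (f := fun x => (hypPolyRev s r).eval x) (by fun_prop)
  obtain ⟨B', hB'⟩ := (isCompact_Icc (a := (1 : ℝ)) (b := 2)).exists_bound_of_continuousOn
    (f := fun x => (hypPolyRev s (r + 1)).eval x) (by fun_prop)
  set G := (∏ i ∈ Finset.range (r + 1), (s + (i : ℝ))) / r.factorial * 4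
  set G' := (∏ i ∈ Finset.range (r + 1 + 1), (s + (i : ℝ))) / (r + 1).factorial * 4
  have hG : 0 ≤ G := by positivity
  have hG' : 0 ≤ G' := by positivity
  refine X_sub_one_pow_dvd_of_bound (M := G' * B + G * B') fun x hx1 hx2 => ?_
  have a1 := abs_rpow_mul_hypPolyRev_sub_le h0 h1 r hx1 hx2
  have a2 := abs_rpow_mul_hypPolyRev_sub_le h0 h1 (r + 1) hx1 hx2
  have b1 := hB x ⟨hx1.le, hx2.le⟩
  have b2 := hB' x ⟨hx1.le, hx2.le⟩
  rw [Real.norm_eq_abs] at b1 b2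
  have hp : (x - 1) ^ (2 * (r + 1) + 1) ≤ (x - 1) ^ (2 * r + 1) :=
    pow_le_pow_of_le_one (by linarith) (by linarith) (by omega)
  have hq : 0 ≤ (x - 1) ^ (2 * r + 1) := pow_nonneg (by linarith) _
  have hB0 := (abs_nonneg _).trans b1
  have hB0' := (abs_nonneg _).trans b2
  rw [eval_sub, eval_mul, eval_mul]
  set y := (hypPolyRev s r).eval x
  set y' := (hypPolyRev s (r + 1)).eval x
  set u := (hypPoly s r).eval x
  set u' := (hypPoly s (r + 1)).eval x
  -- Eliminating `x^s` writes the determinant in terms of the two remainders, each of order at least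
  -- `2r+1` at `1`.
  calc |u * y' - u' * y| = |(x ^ s * y' - u') * y - (x ^ s * y - u) * y'| := by congr 1; ring
    _ ≤ |(x ^ s * y' - u') * y| + |(x ^ s * y - u) * y'| := abs_sub _ _
    _ = |x ^ s * y' - u'| * |y| + |x ^ s * y - u| * |y'| := by rw [abs_mul, abs_mul]
    _ ≤ G' * (x - 1) ^ (2 * r + 1) * B + G * (x - 1) ^ (2 * r + 1) * B' := by
        gcongr
        exact a2.trans (mul_le_mul_of_nonneg_left hp hG')
    _ = _ := by ring

lemma hyp_det_ne_zero {s : ℝ} (h0 : 0 < s) (h1 : s < 1) (r : ℕ) {z : ℂ} (hz : z ≠ 1) :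
    aeval z (hypPoly s r) * aeval z (hypPolyRev s (r + 1))
      ≠ aeval z (hypPoly s (r + 1)) * aeval z (hypPolyRev s r) := by
  have hF0 : (hypPoly s r * hypPolyRev s (r + 1) - hypPoly s (r + 1) * hypPolyRev s r).eval 0 ≠ 0 := by
    rw [eval_sub, eval_mul, eval_mul, eval_zero_hypPoly, eval_zero_hypPoly, eval_zero_hypPolyRev,
      eval_zero_hypPolyRev, one_mul, one_mul]
    exact (sub_pos.2 (hypCoeff_self_lt_succ h0 h1 r)).ne'
  have hdeg : (hypPoly s r * hypPolyRev s (r + 1) - hypPoly s (r + 1) * hypPolyRev s r).natDegree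
      ≤ 2 * r + 1 := by
    have d1 := natDegree_hypPoly_le s r
    have d2 := natDegree_hypPoly_le s (r + 1)
    have d3 := natDegree_hypPolyRev_le s r
    have d4 := natDegree_hypPolyRev_le s (r + 1)
    refine (natDegree_sub_le _ _).trans (max_le ?_ ?_)
    · exact natDegree_mul_le.trans (by omega)
    · exact natDegree_mul_le.trans (by omega)
  obtain ⟨G, hG⟩ := X_sub_one_pow_dvd_det h0 h1 r
  rw [hG] at hF0 hdeg
  have hG0 : G ≠ 0 := by rintro rfl; simp at hF0
  -- The degree is at most `2r+1`, so the cofactor of `(X - 1)^(2r+1)` is a constant, nonzero by the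
  -- value at `0`.
  have hdegG : G.natDegree = 0 := by
    rw [(monic_X_sub_C (1 : ℝ)).pow _ |>.natDegree_mul' hG0, natDegree_pow, natDegree_X_sub_C] at hdeg
    omega
  obtain ⟨g, rfl⟩ := natDegree_eq_zero.1 hdegG
  have hg : g ≠ 0 := by rintro rfl; simp at hG0
  rw [← sub_ne_zero, ← map_mul, ← map_mul, ← map_sub, hG]
  simp [hg, sub_eq_zero, hz]

/-! ### From good approximations to an irrationality measure -/

/-- There is only one infinite place, so the condition at the other places in the product formula
argument is vacuous. -/
lemma one_le_norm_of_ne_zero {K : Type*} [Field K] [NumberField K] [NumberField.IsTotallyComplex K]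
    (hK : Module.finrank ℚ K = 2) (φ : K →+* ℂ) {x : 𝓞 K} (hx : x ≠ 0) : 1 ≤ ‖φ (x : K)‖ := by
  have hcard : Fintype.card (InfinitePlace K) = 1 := by
    have h1 := NumberField.IsTotallyComplex.finrank K
    have h2 := InfinitePlace.card_eq_nrRealPlaces_add_nrComplexPlaces K
    rw [NumberField.IsTotallyComplex.nrRealPlaces_eq_zero] at h2
    omega
  have hsub : Subsingleton (InfinitePlace K) := Fintype.card_le_one_iff_subsingleton.1 hcard.le
  exact InfinitePlace.one_le_of_lt_one (w := InfinitePlace.mk φ) hx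
    fun z hz => (hz (Subsingleton.elim _ _)).elim

/-- Good approximations `P r / R r` to `θ`, with consecutive ones distinct, bound the approximation
of `θ` by arbitrary quotients of integers of `K`. -/
lemma lt_norm_sub_div_of_approx {K : Type*} [Field K] [NumberField K] (φ : K →+* ℂ)
    (hφ : ∀ x : 𝓞 K, x ≠ 0 → 1 ≤ ‖φ (x : K)‖) (θ : ℂ) (P R : ℕ → 𝓞 K) {k₀ l₀ E Q : ℝ}
    (hQ0 : 0 < Q) (hE : 1 < E) (hl : 1 ≤ 2 * l₀)
    (hR : ∀ r, ‖φ (R r : K)‖ < k₀ * Q ^ r)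
    (hP : ∀ r, ‖φ (R r : K) * θ - φ (P r : K)‖ ≤ l₀ * (E ^ r)⁻¹)
    (hdet : ∀ r, P r * R (r + 1) ≠ P (r + 1) * R r) (p q : 𝓞 K) (hq : q ≠ 0) :
    1 / (2 * k₀ * Q * (2 * l₀ * E) ^ (Real.log Q / Real.log E)
      * ‖φ (q : K)‖ ^ (Real.log Q / Real.log E + 1)) < ‖θ - φ (p : K) / φ (q : K)‖ := by
  have hk₀ : 0 < k₀ := by
    have := (norm_nonneg _).trans_lt (hR 0)
    simpa using this
  have hE0 : 0 < E := by linarith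
  -- If `Q < 1`, the integers `R r` eventually have absolute value below `1`, hence vanish, and
  -- consecutive determinants would be zero.
  have hQ1 : 1 ≤ Q := by
    by_contra! hlt
    obtain ⟨m, hm⟩ := exists_pow_lt_of_lt_one (inv_pos.2 hk₀) hlt
    have hz : ∀ r, m ≤ r → R r = 0 := by
      intro r hr
      by_contra hne
      have h1 := hφ _ hne
      have h2 := hR r
      have h3 : k₀ * Q ^ r ≤ k₀ * Q ^ m :=
        mul_le_mul_of_nonneg_left (pow_le_pow_of_le_one hQ0.le hlt.le hr) hk₀.le
      have h4 : k₀ * Q ^ m < k₀ * k₀⁻¹ := mul_lt_mul_of_pos_left hm hk₀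
      rw [mul_inv_cancel₀ hk₀.ne'] at h4
      linarith
    exact hdet m (by rw [hz m le_rfl, hz (m + 1) (by omega), mul_zero, mul_zero])
  set κ := Real.log Q / Real.log E with hκ
  have hlogE : 0 < Real.log E := Real.log_pos hE
  have hκ0 : 0 ≤ κ := div_nonneg (Real.log_nonneg hQ1) hlogE.le
  have hQE : Q = E ^ κ := by
    rw [Real.rpow_def_of_pos hE0, hκ, mul_div_cancel₀ _ hlogE.ne', Real.exp_log hQ0]
  set x := ‖φ (q : K)‖ with hx
  have hx1 : 1 ≤ x := hφ q hq
  have hx0 : 0 < x := by linarith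
  have hl0 : 0 < l₀ := by linarith
  have hφq : φ (q : K) ≠ 0 := norm_pos_iff.1 hx0
  classical
  have hex : ∃ r : ℕ, 2 * l₀ * x < E ^ r := pow_unbounded_of_one_lt _ hE
  -- The least `r` with `E^r > 2 l₀ |q|`. It cannot be `0`, because `2 l₀ ≥ 1` and `|q| ≥ 1`;
  -- minimality gives the upper bound.
  obtain ⟨r, hr, hrmin⟩ : ∃ r : ℕ, 2 * l₀ * x < E ^ r ∧ E ^ r ≤ 2 * l₀ * E * x := by
    refine ⟨Nat.find hex, Nat.find_spec hex, ?_⟩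
    rcases Nat.eq_zero_or_pos (Nat.find hex) with h | h
    · have := Nat.find_spec hex
      rw [h, pow_zero] at this
      nlinarith
    · have := Nat.find_min hex (Nat.sub_lt h one_pos)
      obtain ⟨t, ht⟩ : ∃ t, Nat.find hex = t + 1 := ⟨Nat.find hex - 1, by omega⟩
      rw [ht] at this ⊢
      simp only [Nat.add_sub_cancel, not_lt] at this
      rw [pow_succ]
      nlinarith
  have hQr : Q ^ r ≤ (2 * l₀ * E) ^ κ * x ^ κ := by
    rw [← Real.mul_rpow (by positivity) hx0.le, hQE, ← Real.rpow_natCast, ← Real.rpow_mul hE0.le,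
      mul_comm, Real.rpow_mul hE0.le, Real.rpow_natCast]
    exact Real.rpow_le_rpow (by positivity) hrmin hκ0
  -- If `p/q` equalled both `P r / R r` and the next quotient, the determinant would vanish.
  obtain ⟨j, hj1, hj2, hj⟩ : ∃ j, r ≤ j ∧ j ≤ r + 1 ∧ p * R j - q * P j ≠ 0 := by
    by_contra! hcon
    have h1 := sub_eq_zero.1 (hcon r le_rfl (by omega))
    have h2 := sub_eq_zero.1 (hcon (r + 1) (by omega) le_rfl)
    refine hdet r (mul_left_cancel₀ hq ?_)
    linear_combination R r * h2 - R (r + 1) * h1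
  have hlow := hφ _ hj
  set δ := ‖θ - φ (p : K) / φ (q : K)‖ with hδ
  have hδ0 : 0 ≤ δ := norm_nonneg _
  have hup : ‖φ ((p * R j - q * P j : 𝓞 K) : K)‖
      ≤ x * ‖φ (R j : K) * θ - φ (P j : K)‖ + ‖φ (R j : K)‖ * x * δ := by
    have : φ ((p * R j - q * P j : 𝓞 K) : K) = φ (q : K) * (φ (R j : K) * θ - φ (P j : K))
        - φ (R j : K) * φ (q : K) * (θ - φ (p : K) / φ (q : K)) := by
      push_cast
      rw [map_sub, map_mul, map_mul]
      field_simp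
      ring
    rw [this, hx, hδ]
    refine (norm_sub_le _ _).trans_eq ?_
    rw [norm_mul, norm_mul, norm_mul]
  have hsmall : x * ‖φ (R j : K) * θ - φ (P j : K)‖ < 1 / 2 := by
    have h1 : (E ^ j)⁻¹ ≤ (E ^ r)⁻¹ :=
      inv_anti₀ (by positivity) (pow_le_pow_right₀ hE.le hj1)
    have h2 : x * ‖φ (R j : K) * θ - φ (P j : K)‖ ≤ x * (l₀ * (E ^ r)⁻¹) :=
      mul_le_mul_of_nonneg_left ((hP j).trans (mul_le_mul_of_nonneg_left h1 hl0.le)) hx0.le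
    refine h2.trans_lt ?_
    rw [← mul_assoc, ← div_eq_mul_inv, div_lt_iff₀ (by positivity)]
    linarith
  have hRj : ‖φ (R j : K)‖ ≤ k₀ * Q * ((2 * l₀ * E) ^ κ * x ^ κ) := by
    calc ‖φ (R j : K)‖ ≤ k₀ * Q ^ j := (hR j).le
      _ ≤ k₀ * Q ^ (r + 1) :=
        mul_le_mul_of_nonneg_left (pow_le_pow_right₀ hQ1 hj2) hk₀.le
      _ = k₀ * Q * Q ^ r := by ring
      _ ≤ _ := mul_le_mul_of_nonneg_left hQr (by positivity)
  -- In `1 ≤ |q| |R_j θ - P_j| + |R_j| |q| δ` the first term is below `1/2`, so the second exceeds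
  -- `1/2`.
  have hfin : 1 / 2 < k₀ * Q * ((2 * l₀ * E) ^ κ * x ^ κ) * x * δ := by
    have : ‖φ (R j : K)‖ * x * δ ≤ k₀ * Q * ((2 * l₀ * E) ^ κ * x ^ κ) * x * δ := by gcongr
    linarith
  rw [div_lt_iff₀ (by positivity), Real.rpow_add_one hx0.ne']
  linarith

/-! ### Integrality of the approximations -/

lemma hypX_map (n r : ℕ) : (hypX n r).map (algebraMap ℚ ℝ) = hypPoly (1 / n) r := by
  ext k
  rw [coeff_map, eq_ratCast, coeff_hypX, hypPoly]
  simp only [finsetSum_coeff, coeff_C_mul_X_pow]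
  rw [Finset.sum_ite_eq]
  split_ifs with h
  · rfl
  · rw [hypCoeff, Nat.choose_eq_zero_of_lt (by simpa using h)]
    simp

lemma natDegree_hypX_le (n r : ℕ) : (hypX n r).natDegree ≤ r :=
  natDegree_sum_le_of_forall_le _ _ fun _ hk => (natDegree_C_mul_X_pow_le _ _).trans
    (Nat.lt_succ_iff.1 (Finset.mem_range.1 hk))

lemma denomD_spec (n r : ℕ) :
    0 < denomD n r ∧ ∀ k : ℕ, ∃ z : ℤ, (denomD n r : ℚ) * (hypX n r).coeff k = (z : ℚ) := by
  refine Nat.sInf_mem (s := {D : ℕ | 0 < D ∧ ∀ k : ℕ, ∃ z : ℤ, (D : ℚ) * (hypX n r).coeff k = z})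
    ⟨∏ k ∈ Finset.range (r + 1), ((hypX n r).coeff k).den, Finset.prod_pos fun k _ => Rat.den_pos _,
      fun k => ?_⟩
  by_cases hk : k ∈ Finset.range (r + 1)
  · obtain ⟨m, hm⟩ := Finset.dvd_prod_of_mem (fun k => ((hypX n r).coeff k).den) hk
    refine ⟨m * ((hypX n r).coeff k).num, ?_⟩
    rw [hm]
    push_cast
    rw [mul_comm _ (m : ℚ), mul_assoc, Rat.den_mul_eq_num]
  · refine ⟨0, ?_⟩
    rw [coeff_eq_zero_of_natDegree_lt]
    · simp
    · exact (natDegree_hypX_le n r).trans_lt (by simpa using hk)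

/-- A zero gcd would kill the constant coefficient of `X_{n,r}(1 - dx)`, which is `X_{n,r}(1)`, a
sum of positive coefficients. -/
lemma numerN_pos {n : ℕ} (hn : 2 ≤ n) (d r : ℕ) : 0 < numerN d n r := by
  rw [Nat.pos_iff_ne_zero, numerN]
  intro h
  have h0 := Finset.gcd_eq_zero_iff.1 h 0 (by simp)
  rw [Int.natAbs_eq_zero, Rat.num_eq_zero, coeff_zero_eq_eval_zero, eval_comp] at h0
  simp only [eval_sub, eval_one, eval_mul, eval_C, eval_X, mul_zero, sub_zero] at h0
  have hn' : (2 : ℝ) ≤ n := by exact_mod_cast hn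
  have h1 : (hypPoly (1 / n) r).eval 1 = 0 := by
    rw [← hypX_map, eval_one_map, h0, map_zero]
  rw [hypPoly, eval_finsetSum] at h1
  simp only [eval_mul, eval_C, eval_pow, eval_X, one_pow, mul_one] at h1
  refine (Finset.sum_pos (fun k hk => hypCoeff_pos (by positivity) ?_
    (Nat.lt_succ_iff.1 (Finset.mem_range.1 hk))) (by simp)).ne' h1
  rw [div_lt_one (by linarith)]
  linarith

/-- The coefficients of `D / N * X_{n,r}(1 - d x)` are integers. -/
lemma exists_int_coeff_comp {n : ℕ} (hn : 2 ≤ n) (d r : ℕ) : ∃ z : ℕ → ℤ, ∀ k,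
    (denomD n r : ℚ) / numerN d n r * ((hypX n r).comp (1 - C (d : ℚ) * X)).coeff k = z k := by
  have hN := numerN_pos hn d r
  have hint : ∀ k, ∃ z : ℤ,
      (denomD n r : ℚ) * ((hypX n r).comp (1 - C (d : ℚ) * X)).coeff k = z := by
    have hl : C (denomD n r : ℚ) * hypX n r ∈ lifts (Int.castRingHom ℚ) := by
      rw [lifts_iff_coeff_lifts]
      intro k
      obtain ⟨z, hz⟩ := (denomD_spec n r).2 k
      exact ⟨z, by rw [coeff_C_mul, hz]; rfl⟩
    obtain ⟨H, hH⟩ := hl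
    rw [coe_mapRingHom] at hH
    intro k
    refine ⟨(H.comp (1 - C (d : ℤ) * X)).coeff k, ?_⟩
    rw [← coeff_C_mul, ← C_comp (p := 1 - C (d : ℚ) * X), ← mul_comp, ← hH]
    rw [← eq_intCast (Int.castRingHom ℚ), ← coeff_map, map_comp]
    simp
  have : ∀ k, ∃ z : ℤ, (denomD n r : ℚ) / numerN d n r *
      ((hypX n r).comp (1 - C (d : ℚ) * X)).coeff k = z := by
    intro k
    by_cases hk : k ∈ Finset.range (r + 1)
    · set x := ((hypX n r).comp (1 - C (d : ℚ) * X)).coeff k with hx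
      obtain ⟨y, hy⟩ := hint k
      have hdvd : (numerN d n r : ℤ) ∣ x.num := by
        rw [Int.natCast_dvd]
        exact Finset.gcd_dvd hk
      obtain ⟨m, hm⟩ := hdvd
      have hden : x.den ∣ denomD n r := by
        have h1 : (denomD n r : ℤ) * x.num = y * x.den := by
          have : (denomD n r : ℚ) * x.num = y * x.den := by
            rw [← hy, mul_assoc, Rat.mul_den_eq_num]
          exact_mod_cast this
        have h2 : (x.den : ℤ) ∣ denomD n r * x.num := ⟨y, by rw [h1, mul_comm]⟩
        have h3 : IsCoprime (x.den : ℤ) x.num := by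
          rw [Int.isCoprime_iff_nat_coprime]
          simpa using x.reduced.symm
        exact_mod_cast h3.dvd_of_dvd_mul_right h2
      obtain ⟨t, ht⟩ := hden
      refine ⟨t * m, ?_⟩
      have hN' : (numerN d n r : ℚ) ≠ 0 := by exact_mod_cast hN.ne'
      have hx' : x * x.den = numerN d n r * m := by
        rw [Rat.mul_den_eq_num, hm]; push_cast; rfl
      rw [ht]
      push_cast
      rw [div_mul_eq_mul_div, div_eq_iff hN']
      linear_combination t * hx'
    · refine ⟨0, ?_⟩
      rw [coeff_eq_zero_of_natDegree_lt, mul_zero, Int.cast_zero]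
      refine lt_of_le_of_lt ?_ (by simpa using hk : r < k)
      refine natDegree_comp_le.trans ?_
      have hL : (1 - C (d : ℚ) * X).natDegree ≤ 1 := by compute_degree
      exact (Nat.mul_le_mul (natDegree_hypX_le n r) hL).trans (by simp)
  choose z hz using this
  exact ⟨z, hz⟩

/-- The values of the homogenized polynomials `D / N * X_{n,r}` at congruent integers modulo `d`
are integers. -/
lemma exists_ringOfIntegers_eq {K : Type*} [Field K] [NumberField K] (φ : K →+* ℂ) {n : ℕ}
    (hn : 2 ≤ n) (d r : ℕ) {u v : 𝓞 K} (hv : v ≠ 0) (huv : (d : 𝓞 K) ∣ v - u) :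
    ∃ y : 𝓞 K, φ (y : K) = ((denomD n r : ℝ) / numerN d n r : ℝ) * (φ (v : K) ^ r *
      aeval (φ (u : K) / φ (v : K)) (hypPoly (1 / n) r)) := by
  obtain ⟨e, he⟩ := huv
  obtain ⟨z, hz⟩ := exists_int_coeff_comp hn d r
  -- With `v - u = d e` one has `u/v = 1 - d (e/v)`; expanding in powers of `e/v` and multiplying by
  -- `v^r` clears all denominators.
  refine ⟨∑ k ∈ Finset.range (r + 1), (z k : 𝓞 K) * (e ^ k * v ^ (r - k)), ?_⟩
  have hv' : φ (v : K) ≠ 0 := by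
    rw [_root_.map_ne_zero]
    exact_mod_cast hv
  have hu : φ (u : K) / φ (v : K) = 1 - d * (φ (e : K) / φ (v : K)) := by
    have : φ (v : K) - φ (u : K) = d * φ (e : K) := by
      rw [← map_sub, ← map_natCast φ, ← map_mul]
      congr 1
      exact_mod_cast congrArg (algebraMap (𝓞 K) K) he
    field_simp
    linear_combination -this
  have hcomp : aeval (φ (u : K) / φ (v : K)) (hypPoly (1 / n) r)
      = aeval (φ (e : K) / φ (v : K)) ((hypX n r).comp (1 - C (d : ℚ) * X)) := by
    rw [← hypX_map, aeval_map_algebraMap, aeval_comp, hu]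
    simp
  have hdeg : ((hypX n r).comp (1 - C (d : ℚ) * X)).natDegree < r + 1 := by
    have hL : (1 - C (d : ℚ) * X).natDegree ≤ 1 := by compute_degree
    exact Nat.lt_succ_iff.2
      (natDegree_comp_le.trans ((Nat.mul_le_mul (natDegree_hypX_le n r) hL).trans (by simp)))
  rw [hcomp, aeval_eq_sum_range' hdeg, Finset.mul_sum, Finset.mul_sum]
  change (φ.comp (algebraMap (𝓞 K) K)) (∑ k ∈ Finset.range (r + 1), _) = _
  rw [map_sum]
  refine Finset.sum_congr rfl fun k hk => ?_
  have hk' : k ≤ r := Nat.lt_succ_iff.1 (Finset.mem_range.1 hk)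
  have hzk : ((denomD n r : ℝ) / numerN d n r : ℝ) *
      ((((hypX n r).comp (1 - C (d : ℚ) * X)).coeff k : ℚ) : ℂ) = z k := by
    have := congrArg (fun q : ℚ => (q : ℂ)) (hz k)
    push_cast at this ⊢
    exact this
  rw [Algebra.smul_def, eq_ratCast, div_pow]
  have hvr : φ (v : K) ^ r = φ (v : K) ^ k * φ (v : K) ^ (r - k) := by
    rw [← pow_add, Nat.add_sub_cancel' hk']
  rw [hvr]
  simp only [map_mul, map_pow, map_intCast, RingHom.comp_apply]
  rw [← hzk]
  field_simp

/-! ### Principal roots and the constants of the hypothesis -/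

lemma IsRealOrCircleLog.exp_half_re_nonneg {w : ℂ} (hw : IsRealOrCircleLog w) :
    0 ≤ (Complex.exp (w / 2)).re := by
  rcases hw with ⟨x, _, rfl⟩ | ⟨x, hx, rfl⟩
  · rw [show (x : ℂ) / 2 = ((x / 2 : ℝ) : ℂ) by push_cast; rfl, ← Complex.ofReal_exp,
      Complex.ofReal_re]
    positivity
  · rw [show (x : ℂ) * Complex.I / 2 = ((x / 2 : ℝ) : ℂ) * Complex.I by push_cast; ring,
      Complex.exp_ofReal_mul_I_re]
    have := abs_lt.1 hx
    exact Real.cos_nonneg_of_mem_Icc ⟨by linarith, by linarith⟩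

lemma isRealOrCircleLog_log_ofReal {t : ℝ} (ht : 1 < t) : IsRealOrCircleLog (Complex.log t) :=
  Or.inl ⟨Real.log t, Real.log_pos ht, (Complex.ofReal_log (by linarith)).symm⟩

lemma isRealOrCircleLog_log_of_norm_eq_one {z : ℂ} (h1 : ‖z‖ = 1) (h2 : z ≠ -1) :
    IsRealOrCircleLog (Complex.log z) := by
  refine Or.inr ⟨z.arg, ?_, by rw [Complex.log, h1]; simp⟩
  refine abs_lt.2 ⟨Complex.neg_pi_lt_arg z, (Complex.arg_le_pi z).lt_of_ne fun h => h2 ?_⟩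
  have := Complex.norm_mul_exp_arg_mul_I z
  rw [h1, h, Complex.exp_pi_mul_I] at this
  simpa using this.symm

lemma norm_sub_one_le_norm_add_one {z : ℂ} (hz : 0 ≤ z.re) : ‖z - 1‖ ≤ ‖z + 1‖ := by
  rw [← sq_le_sq₀ (norm_nonneg _) (norm_nonneg _), Complex.sq_norm, Complex.sq_norm,
    Complex.normSq_apply, Complex.normSq_apply]
  simp
  nlinarith

/-- The principal square roots of `a` and `b` satisfy `√a = ±σ√b`, with a sign depending on the
arguments. Taking the minimum and the maximum removes this ambiguity. -/
lemma min_max_norm_sub_add {x y σ : ℂ} (hσ : 0 ≤ σ.re) (h : x ^ 2 = σ ^ 2 * y ^ 2) :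
    min ‖x - y‖ ‖x + y‖ = ‖y‖ * ‖σ - 1‖ ∧ max ‖x - y‖ ‖x + y‖ = ‖y‖ * ‖σ + 1‖ := by
  have hle : ‖y‖ * ‖σ - 1‖ ≤ ‖y‖ * ‖σ + 1‖ :=
    mul_le_mul_of_nonneg_left (norm_sub_one_le_norm_add_one hσ) (norm_nonneg _)
  rw [← mul_pow, sq_eq_sq_iff_eq_or_eq_neg] at h
  rcases h with rfl | rfl
  · have e1 : ‖σ * y - y‖ = ‖y‖ * ‖σ - 1‖ := by rw [← norm_mul]; congr 1; ring
    have e2 : ‖σ * y + y‖ = ‖y‖ * ‖σ + 1‖ := by rw [← norm_mul]; congr 1; ring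
    rw [e1, e2, min_eq_left hle, max_eq_right hle]
    exact ⟨rfl, rfl⟩
  · have e1 : ‖-(σ * y) - y‖ = ‖y‖ * ‖σ + 1‖ := by rw [← norm_mul, ← norm_neg]; congr 1; ring
    have e2 : ‖-(σ * y) + y‖ = ‖y‖ * ‖σ - 1‖ := by rw [← norm_mul, ← norm_neg]; congr 1; ring
    rw [e1, e2, min_eq_right hle, max_eq_left hle]
    exact ⟨rfl, rfl⟩

lemma scriptN_pos (d n : ℕ) : 0 < scriptN d n :=
  Finset.prod_pos fun _ hp => Real.rpow_pos_of_pos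
    (by exact_mod_cast (Nat.prime_of_mem_primeFactors hp).pos) _

lemma hypFactor_eq_Gamma {s : ℝ} (h1 : s < 1) (r : ℕ) :
    hypFactor s r = Real.Gamma (1 - s) * r.factorial / Real.Gamma (r + 1 - s) := by
  have h := Gamma_add_natCast_eq_prod (sub_pos.2 h1) r
  have hg := (Real.Gamma_pos_of_pos (sub_pos.2 h1)).ne'
  rw [show (r : ℝ) + 1 - s = 1 - s + r by ring, h, hypFactor, mul_comm (Real.Gamma (1 - s)),
    mul_div_mul_right _ _ hg]

lemma prod_div_factorial_eq_Gamma {n : ℕ} (hn : 0 < n) (r : ℕ) :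
    (∏ i ∈ Finset.range (r + 1), (1 / (n : ℝ) + i)) / r.factorial
      = (n * Real.Gamma (r + 1 + 1 / n) / (Real.Gamma (1 / n) * r.factorial)) / n := by
  have hn' : (0 : ℝ) < n := by exact_mod_cast hn
  have hs : 0 < 1 / (n : ℝ) := by positivity
  have h := Gamma_add_natCast_eq_prod hs (r + 1)
  have hg := (Real.Gamma_pos_of_pos hs).ne'
  have hf : (r.factorial : ℝ) ≠ 0 := by positivity
  rw [show (r : ℝ) + 1 + 1 / n = 1 / n + (r + 1 : ℕ) by push_cast; ring, h]
  field_simp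

lemma IsAdmissible.hypFactor_lt {d n : ℕ} {Cn Dn : ℝ} (h : IsAdmissible d n Cn Dn) (hn : 2 ≤ n)
    (r : ℕ) : hypFactor (1 / n) r * ((denomD n r : ℝ) / numerN d n r)
      < Cn * (Dn / scriptN d n) ^ r := by
  have hn' : (2 : ℝ) ≤ n := by exact_mod_cast hn
  refine lt_of_le_of_lt (mul_le_mul_of_nonneg_right ?_ (by positivity)) (h.2.2 r)
  rw [hypFactor_eq_Gamma (by rw [div_lt_one (by linarith)]; linarith)]
  exact le_max_of_le_right (le_max_left _ _)

/-- The product is the Gamma quotient of the hypothesis divided by `n`; the gain `1/3` is `1/n` for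
`n ≥ 3`. -/
lemma IsAdmissible.prod_div_factorial_le {d n : ℕ} {Cn Dn : ℝ} (h : IsAdmissible d n Cn Dn)
    (hn : 3 ≤ n) (r : ℕ) : (∏ i ∈ Finset.range (r + 1), (1 / (n : ℝ) + i)) / r.factorial *
      ((denomD n r : ℝ) / numerN d n r) ≤ Cn * (Dn / scriptN d n) ^ r / 3 := by
  have hn' : (3 : ℝ) ≤ n := by exact_mod_cast hn
  rw [prod_div_factorial_eq_Gamma (by omega)]
  set g := n * Real.Gamma (r + 1 + 1 / n) / (Real.Gamma (1 / n) * r.factorial) with hg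
  have hg0 : 0 ≤ g := by
    have h1 := Real.Gamma_pos_of_pos (show (0 : ℝ) < r + 1 + 1 / n by positivity)
    have h2 := Real.Gamma_pos_of_pos (show (0 : ℝ) < 1 / n by positivity)
    positivity
  have hlt : g * ((denomD n r : ℝ) / numerN d n r) ≤ Cn * (Dn / scriptN d n) ^ r :=
    (mul_le_mul_of_nonneg_right (le_max_of_le_right (le_max_right _ _)) (by positivity)).trans
      (h.2.2 r).le
  calc _ ≤ g / 3 * ((denomD n r : ℝ) / numerN d n r) := by gcongr
    _ = g * ((denomD n r : ℝ) / numerN d n r) / 3 := by ring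
    _ ≤ _ := by gcongr

lemma one_le_denomD_div_numerN_zero {n : ℕ} (hn : 2 ≤ n) (d : ℕ) :
    1 ≤ (denomD n 0 : ℝ) / numerN d n 0 := by
  obtain ⟨z, hz⟩ := exists_int_coeff_comp hn d 0
  have h0 := hz 0
  have h1 : hypX n 0 = 1 := by simp [hypX, ordinaryHypergeometricCoefficient]
  rw [h1, one_comp, coeff_one_zero, mul_one] at h0
  have h2 : (0 : ℚ) < (denomD n 0 : ℚ) / numerN d n 0 :=
    div_pos (by exact_mod_cast (denomD_spec n 0).1) (by exact_mod_cast numerN_pos hn d 0)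
  rw [h0] at h2
  have h3 : (1 : ℚ) ≤ z 0 := by
    have : 0 < z 0 := by exact_mod_cast h2
    exact_mod_cast this
  rw [← h0] at h3
  have h4 := (Rat.cast_le (K := ℝ)).2 h3
  push_cast at h4
  exact h4

lemma IsAdmissible.one_lt {d n : ℕ} {Cn Dn : ℝ} (h : IsAdmissible d n Cn Dn) (hn : 2 ≤ n) :
    1 < Cn := by
  have h0 := h.2.2 0
  rw [pow_zero, mul_one] at h0
  refine lt_of_le_of_lt ?_ h0
  exact one_le_mul_of_one_le_of_one_le (le_max_left _ _) (one_le_denomD_div_numerN_zero hn d)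

lemma aeval_hypPolyRev_eq (s : ℝ) (r : ℕ) {z : ℂ} (hz : z ≠ 0) :
    aeval z (hypPolyRev s r) = z ^ r * aeval z⁻¹ (hypPoly s r) := by
  rw [aeval_hypPolyRev, aeval_hypPoly, Finset.mul_sum]
  refine Finset.sum_congr rfl fun k hk => ?_
  have hk' : k ≤ r := Nat.lt_succ_iff.1 (Finset.mem_range.1 hk)
  rw [pow_sub₀ z hz hk', inv_pow]
  ring

/-! ### The approximation theorem -/

theorem corollary2p3
    -- an imaginary quadratic field `K`, viewed inside `ℂ` through an embedding `φ`
    (K : Type*) [Field K] [NumberField K] [NumberField.IsTotallyComplex K]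
    (hK : Module.finrank ℚ K = 2) (φ : K →+* ℂ)
    (n : ℕ) (hn : 3 ≤ n)
    (a b : 𝓞 K) (hab : Ideal.span {a, b} = ⊤)
    (hquot : (∃ t : ℚ, 1 < t ∧ (a : K) / (b : K) = (t : K)) ∨
      (‖φ (a : K) / φ (b : K)‖ = 1 ∧ φ (a : K) / φ (b : K) ≠ -1))
    -- `d` is the largest positive rational integer dividing `a - b` (so `a ≠ b`)
    (d : ℕ) (hd : IsGreatest {k : ℕ | 0 < k ∧ (k : 𝓞 K) ∣ a - b} d)
    (Cn Dn : ℝ) (hCD : IsAdmissible d n Cn Dn)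
    (E Q κ c : ℝ)
    (hE : E = scriptN d n / Dn *
      (min ‖φ (a : K) ^ (1 / 2 : ℂ) - φ (b : K) ^ (1 / 2 : ℂ)‖
        ‖φ (a : K) ^ (1 / 2 : ℂ) + φ (b : K) ^ (1 / 2 : ℂ)‖) ^ (-2 : ℤ))
    (hQ : Q = Dn / scriptN d n *
      (max ‖φ (a : K) ^ (1 / 2 : ℂ) - φ (b : K) ^ (1 / 2 : ℂ)‖
        ‖φ (a : K) ^ (1 / 2 : ℂ) + φ (b : K) ^ (1 / 2 : ℂ)‖) ^ 2)
    (hκ : κ = Real.log Q / Real.log E)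
    (hc : c = 4 * ‖φ (a : K)‖ * Cn * Q *
      ((5 / 2 : ℝ) * ‖φ (a : K) * (φ (a : K) - φ (b : K)) / φ (b : K)‖ * Cn * E) ^ κ)
    (hE1 : 1 < E)
    (p q : 𝓞 K) (hq : q ≠ 0) :
    ‖(φ (a : K) / φ (b : K)) ^ (1 / (n : ℂ)) - φ (p : K) / φ (q : K)‖ >
      1 / (c * ‖φ (q : K)‖ ^ (κ + 1)) := by
  have hφ : ∀ x : 𝓞 K, x ≠ 0 → 1 ≤ ‖φ (x : K)‖ := fun x hx => one_le_norm_of_ne_zero hK φ hx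
  have hne : a ≠ b := by
    rintro rfl
    -- If `a = b`, every positive integer divides `a - b`, and none is greatest.
    have := hd.2 (show d + 1 ∈ {k : ℕ | 0 < k ∧ (k : 𝓞 K) ∣ a - a} from ⟨by omega, by simp⟩)
    omega
  have hω0 : φ (a : K) / φ (b : K) ≠ 0 := by
    rcases hquot with ⟨t, ht, h⟩ | ⟨h, -⟩
    · rw [← map_div₀, h, map_ratCast]
      exact_mod_cast (by linarith : (0 : ℚ) < t).ne'
    · intro h0
      rw [h0, norm_zero] at h
      exact zero_ne_one h
  have hw : IsRealOrCircleLog (Complex.log (φ (a : K) / φ (b : K))) := by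
    rcases hquot with ⟨t, ht, h⟩ | ⟨h, h'⟩
    · rw [← map_div₀, h, map_ratCast, ← Complex.ofReal_ratCast]
      exact isRealOrCircleLog_log_ofReal (by exact_mod_cast ht)
    · exact isRealOrCircleLog_log_of_norm_eq_one h h'
  have hA : φ (a : K) ≠ 0 := (div_ne_zero_iff.1 hω0).1
  have hB : φ (b : K) ≠ 0 := (div_ne_zero_iff.1 hω0).2
  have ha : a ≠ 0 := by rintro rfl; simp at hA
  have hb : b ≠ 0 := by rintro rfl; simp at hB
  have hA1 := hφ a ha
  have hB1 := hφ b hb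
  have hAB1 : 1 ≤ ‖φ (a : K) - φ (b : K)‖ := by
    have := hφ (a - b) (sub_ne_zero.2 hne)
    rwa [show ((a - b : 𝓞 K) : K) = (a : K) - (b : K) by push_cast; rfl, map_sub] at this
  set A := φ (a : K) with hAdef
  set B := φ (b : K) with hBdef
  set w := Complex.log (A / B) with hwdef
  have hexp : Complex.exp w = A / B := Complex.exp_log hω0
  set σ := Complex.exp (w / 2) with hσdef
  have hσ2 : σ ^ 2 = A / B := by
    rw [← hexp, hσdef, ← Complex.exp_nat_mul]; congr 1; push_cast; ring
  have hσ0 : σ ≠ 0 := Complex.exp_ne_zero _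
  have hsqrt : ∀ z : ℂ, (z ^ (1 / 2 : ℂ)) ^ 2 = z := fun z => by
    rw [one_div]; exact_mod_cast Complex.cpow_nat_inv_pow z two_ne_zero
  obtain ⟨hmin, hmax⟩ := min_max_norm_sub_add (x := A ^ (1 / 2 : ℂ)) (y := B ^ (1 / 2 : ℂ))
    hw.exp_half_re_nonneg (by rw [hsqrt, hsqrt, hσ2, div_mul_cancel₀ _ hB])
  have hyB : ‖B ^ (1 / 2 : ℂ)‖ ^ 2 = ‖B‖ := by rw [← norm_pow, hsqrt]
  have hn2 : 2 ≤ n := by omega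
  have hs0 : 0 < 1 / (n : ℝ) := by positivity
  have hs1 : 1 / (n : ℝ) < 1 := by
    have : (3 : ℝ) ≤ n := by exact_mod_cast hn
    rw [div_lt_one (by linarith)]; linarith
  have hSN := scriptN_pos d n
  obtain ⟨hC0, hD0, -⟩ := id hCD
  have hC1 := hCD.one_lt hn2
  have hQ' : Q = Dn / scriptN d n * (‖B‖ * ‖σ + 1‖ ^ 2) := by
    rw [hQ, hmax, mul_pow, hyB]
  have hE' : E⁻¹ = Dn / scriptN d n * (‖B‖ * ‖σ - 1‖ ^ 2) := by
    rw [hE, hmin, mul_inv, zpow_neg, inv_inv, inv_div, ← hyB]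
    norm_cast
    rw [mul_pow]
  have hσ1 : σ + 1 ≠ 0 := fun h => by
    have h1 := hw.exp_half_re_nonneg
    rw [← hσdef, eq_neg_of_add_eq_zero_left h] at h1
    norm_num at h1
  have hQ0 : 0 < Q := by
    rw [hQ']
    have := norm_pos_iff.2 hB
    have := norm_pos_iff.2 hσ1
    positivity
  have hd1 : (d : 𝓞 K) ∣ a - b := hd.1.2
  choose R hR using fun r => exists_ringOfIntegers_eq φ hn2 d r ha hd1
  choose P hP using fun r => exists_ringOfIntegers_eq φ hn2 d r hb
    (show (d : 𝓞 K) ∣ b - a by rw [← neg_sub]; exact hd1.neg_right)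
  simp only [← hAdef, ← hBdef] at hR hP
  -- Rewriting `a^r X_r(b/a)` as `b^r` times the reciprocal polynomial at `a/b` puts `R` and `P` in
  -- the form of the Padé remainder.
  have hR' : ∀ r, φ (R r : K) = ((denomD n r : ℝ) / numerN d n r : ℝ) * (B ^ r *
      aeval (A / B) (hypPolyRev (1 / n) r)) := fun r => by
    rw [hR, aeval_hypPolyRev_eq _ _ hω0, inv_div, div_pow]
    field_simp
  have hDN : ∀ r, (0 : ℝ) < (denomD n r : ℝ) / numerN d n r := fun r =>
    div_pos (by exact_mod_cast (denomD_spec n r).1) (by exact_mod_cast numerN_pos hn2 d r)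
  have hω1 : A / B ≠ 1 := fun h => by
    rw [div_eq_one_iff_eq hB] at h
    rw [h, sub_self, norm_zero] at hAB1
    linarith
  have hdet : ∀ r, P r * R (r + 1) ≠ P (r + 1) * R r := by
    intro r h
    have h1 : φ (P r : K) * φ (R (r + 1) : K) = φ (P (r + 1) : K) * φ (R r : K) := by
      have := congrArg (φ.comp (algebraMap (𝓞 K) K)) h
      simpa only [map_mul, RingHom.comp_apply] using this
    rw [hP, hP, hR', hR'] at h1
    have d1 : (((denomD n r : ℝ) / numerN d n r : ℝ) : ℂ) ≠ 0 := by exact_mod_cast (hDN r).ne'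
    have d2 : (((denomD n (r + 1) : ℝ) / numerN d n (r + 1) : ℝ) : ℂ) ≠ 0 := by
      exact_mod_cast (hDN (r + 1)).ne'
    refine hyp_det_ne_zero hs0 hs1 r hω1 (mul_left_cancel₀ (mul_ne_zero (mul_ne_zero d1 d2)
      (mul_ne_zero (pow_ne_zero r hB) (pow_ne_zero (r + 1) hB))) ?_)
    linear_combination h1
  have hRb : ∀ r, ‖φ (R r : K)‖ < 2 * ‖A‖ * Cn * Q ^ r := by
    intro r
    have hx := norm_sum_hypCoeff_mul_exp_neg_le hs0 hs1 r hw
    rw [← aeval_hypPoly, Complex.exp_neg, hexp, inv_div, Complex.exp_neg, ← hσdef] at hx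
    have hAσ : ‖A‖ * ‖1 + σ⁻¹‖ ^ 2 = ‖B‖ * ‖σ + 1‖ ^ 2 := by
      rw [← norm_pow, ← norm_pow, ← norm_mul, ← norm_mul]
      congr 1
      have : A = σ ^ 2 * B := by rw [hσ2, div_mul_cancel₀ _ hB]
      rw [this]
      field_simp
    rw [hR, norm_mul, Complex.norm_real, Real.norm_of_nonneg (hDN r).le, norm_mul, norm_pow]
    have hpos : 0 < (‖B‖ * ‖σ + 1‖ ^ 2) ^ r := by
      have := norm_pos_iff.2 hB
      have := norm_pos_iff.2 hσ1
      positivity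
    calc (denomD n r : ℝ) / numerN d n r * (‖A‖ ^ r * ‖aeval (B / A) (hypPoly (1 / n) r)‖)
        ≤ (denomD n r : ℝ) / numerN d n r * (‖A‖ ^ r *
          (hypFactor (1 / n) r * (2 * (‖1 + σ⁻¹‖ ^ 2) ^ r))) := by gcongr
      _ = 2 * (hypFactor (1 / n) r * ((denomD n r : ℝ) / numerN d n r)) *
          (‖A‖ * ‖1 + σ⁻¹‖ ^ 2) ^ r := by rw [mul_pow]; ring
      _ < 2 * (Cn * (Dn / scriptN d n) ^ r) * (‖B‖ * ‖σ + 1‖ ^ 2) ^ r := by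
          rw [hAσ]
          exact mul_lt_mul_of_pos_right
            (mul_lt_mul_of_pos_left (hCD.hypFactor_lt hn2 r) two_pos) hpos
      _ = 2 * 1 * Cn * Q ^ r := by rw [hQ', mul_pow _ (‖B‖ * _)]; ring
      -- The factor `‖A‖ ≥ 1` is not needed for the estimate; it is inserted to match the constant
      -- `c`.
      _ ≤ 2 * ‖A‖ * Cn * Q ^ r := by gcongr
  have hθ : (A / B) ^ (1 / (n : ℂ)) = Complex.exp (((1 / n : ℝ) : ℂ) * w) := by
    rw [Complex.cpow_def_of_ne_zero hω0, ← hwdef, mul_comm]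
    push_cast
    rfl
  have hPb : ∀ r, ‖φ (R r : K) * (A / B) ^ (1 / (n : ℂ)) - φ (P r : K)‖
      ≤ 5 / 4 * ‖A * (A - B) / B‖ * Cn * (E ^ r)⁻¹ := by
    intro r
    have hx := norm_hyp_remainder_le hs0 hs1 r hw
    rw [hexp, ← aeval_hypPoly, ← aeval_hypPolyRev, ← hσdef, ← hθ] at hx
    have e : φ (R r : K) * (A / B) ^ (1 / (n : ℂ)) - φ (P r : K)
        = ((denomD n r : ℝ) / numerN d n r : ℝ) * (B ^ r *
          ((A / B) ^ (1 / (n : ℂ)) * aeval (A / B) (hypPolyRev (1 / n) r)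
            - aeval (A / B) (hypPoly (1 / n) r))) := by
      rw [hR', hP]; ring
    have hAB : ‖A / B - 1‖ * ‖A / B‖ ≤ ‖A * (A - B) / B‖ := by
      rw [← norm_mul, show (A / B - 1) * (A / B) = A * (A - B) / B / B by field_simp, norm_div _ B]
      exact div_le_self (norm_nonneg _) hB1
    rw [e, norm_mul, Complex.norm_real, Real.norm_of_nonneg (hDN r).le, norm_mul, norm_pow]
    calc _ ≤ (denomD n r : ℝ) / numerN d n r * (‖B‖ ^ r *
          ((∏ i ∈ Finset.range (r + 1), (1 / (n : ℝ) + i)) / r.factorial *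
            (2 * ‖A / B - 1‖ * ‖A / B‖ * (‖σ - 1‖ ^ 2) ^ r))) := by gcongr
      _ = (∏ i ∈ Finset.range (r + 1), (1 / (n : ℝ) + i)) / r.factorial *
          ((denomD n r : ℝ) / numerN d n r) *
            (2 * (‖A / B - 1‖ * ‖A / B‖)) * (‖B‖ * ‖σ - 1‖ ^ 2) ^ r := by rw [mul_pow]; ring
      _ ≤ Cn * (Dn / scriptN d n) ^ r / 3 * (2 * ‖A * (A - B) / B‖) *
          (‖B‖ * ‖σ - 1‖ ^ 2) ^ r := by
          gcongr
          exact hCD.prod_div_factorial_le hn r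
      _ = 2 / 3 * ‖A * (A - B) / B‖ * Cn * (E ^ r)⁻¹ := by
          rw [← inv_pow, hE', mul_pow _ (‖B‖ * _)]; ring
      -- The estimate yields `2/3`; the weaker `5/4` is half of the constant `2.5` in `c`.
      _ ≤ _ := by gcongr ?_ * _ * _ * _; norm_num
  have hl : 1 ≤ 2 * (5 / 4 * ‖A * (A - B) / B‖ * Cn) := by
    have hω : 1 ≤ ‖A / B‖ := by
      rw [← hexp, Complex.norm_exp]
      exact Real.one_le_exp hw.re_nonneg
    have h1 : 1 ≤ ‖A * (A - B) / B‖ := by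
      rw [show A * (A - B) / B = A / B * (A - B) by ring, norm_mul]
      exact one_le_mul_of_one_le_of_one_le hω hAB1
    nlinarith
  have key := lt_norm_sub_div_of_approx φ hφ _ P R hQ0 hE1 hl hRb hPb hdet p q hq
  rw [show 2 * (5 / 4 * ‖A * (A - B) / B‖ * Cn) * E = 5 / 2 * ‖A * (A - B) / B‖ * Cn * E by ring,
    show 2 * (2 * ‖A‖ * Cn) * Q = 4 * ‖A‖ * Cn * Q by ring, ← hκ, ← hc] at key
  exact key

end
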